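/- All graphs are finite. For a graph $G$ let $v(G)$ and $e(G)$ be its numbers of vertices and edges, and let $m(G)=\max\{e(G')/v(G') : G'\subseteq G,\ v(G')\ge 1\}$. For a graph $H$ and an integer $b\ge 1$, in the $(1:b)$ vertex $H$-game on a graph $G$ two players, Maker and Breaker, alternately claim previously unclaimed vertices of $G$ until none are left; Maker claims one vertex per move and Breaker claims $b$ vertices per move (all remaining vertices if fewer than $b$ remain). Maker wins if the subgraph of $G$ induced by the vertices he has claimed by the end of the game contains a (not necessarily induced) copy of $H$; otherwise Breaker wins. We say that Maker wins the game on $G$ if he has a winning strategy. Theorem. Let $b$ be a positive integer. 1. For every tree $H$ there exists a tree $T$ such that Maker wins the $(1:b)$ vertex $H$-game on $T$, both when he moves first and when Breaker moves first. 2. Let $H$ be a forest with at least one edge and with connected components $T_1,\dots,T_k$ ($k\ge 1$). For every $1\le i\le k$ let $T_{\min}^{(i)}$ be a tree with the minimum number of vertices among all trees on which Maker, moving first, wins the $(1:b)$ vertex $T_i$-game, and let $T_{\max}$ be one with the maximum number of vertices among $T_{\min}^{(1)},\dots,T_{\min}^{(k)}$. Then $$n^{-1/m(T_{\max})}=n^{-v(T_{\max})/e(T_{\max})},$$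 and this function $p^*=p^*(n)$ is a threshold for Maker's win in the $(1:b)$ vertex $H$-game on the binomial random graph $G(n,p)$, no matter which player moves first: for every $p=p(n)\in[0,1]$, $$\lim_{n\to\infty}\Pr\left[\text{Maker wins the }(1:b)\text{ vertex }H\text{-game on }G(n,p)\right]=\begin{cases}1 & \text{if } p=\omega(p^*),\\ 0 & \text{if } p=o(p^*).\end{cases}$$ -/

import Mathlib

open Filter Topology Asymptotics

namespace VertexGame

/-- The two players of a Maker-Breaker game. -/
inductive Player : Type
  | maker
  | breaker

/-- `MakerWinsFrom b Win t M F`: Maker has a winning strategy in the `(1:b)` Maker-Breaker game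
from the position in which `M` is the set of elements already claimed by Maker, `F` is the set of
free elements and player `t` is about to move. In his turn Maker claims one free element, in his
turn Breaker claims `b` free elements (all the free elements, if there are fewer than `b`). The game
ends when no free element is left, and Maker has won if his final set `M` satisfies `Win`. -/
inductive MakerWinsFrom {X : Type*} [DecidableEq X] (b : ℕ) (Win : Finset X → Prop) :
    Player → Finset X → Finset X → Prop
  | finished (t : Player) (M : Finset X) (hM : Win M) : MakerWinsFrom b Win t M ∅
  | makerMove (M F : Finset X) (x : X) (hx : x ∈ F)
      (h : MakerWinsFrom b Win Player.breaker (insert x M) (F.erase x)) :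
      MakerWinsFrom b Win Player.maker M F
  | breakerMove (M F : Finset X) (hF : F.Nonempty)
      (h : ∀ S : Finset X, S ⊆ F → S.card = min b F.card →
        MakerWinsFrom b Win Player.maker M (F \ S)) :
      MakerWinsFrom b Win Player.breaker M F

/-- Maker wins the `(1:b)` vertex `H`-game played on `V(G)`, where `first` is the player who moves
first: Maker can ensure that the subgraph of `G` induced by his vertices at the end of the game
contains a (not necessarily induced) copy of `H`. -/
def MakerWins {U V : Type*} [Fintype V] [DecidableEq V] (b : ℕ) (first : Player)
    (H : SimpleGraph U) (G : SimpleGraph V) : Prop :=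
  MakerWinsFrom b (fun M : Finset V => H.IsContained (G.induce (M : Set V))) first
    ∅ Finset.univ

/-- `T` is a tree with the least possible number of vertices among all (finite) trees on whose
vertex set Maker, as the first player, wins the `(1:b)` vertex `A`-game. -/
def IsMinMakerTree {U W : Type*} [Fintype W] [DecidableEq W] (b : ℕ)
    (A : SimpleGraph U) (T : SimpleGraph W) : Prop :=
  T.IsTree ∧ MakerWins b Player.maker A T ∧
    ∀ (m : ℕ) (T' : SimpleGraph (Fin m)),
      T'.IsTree → MakerWins b Player.maker A T' → Fintype.card W ≤ m

/-- The maximum density `m(G) = max {e(K) / v(K) : K ⊆ G}` of a finite graph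
(the empty subgraph contributes `0 / 0 = 0`, which does not affect the maximum when `G` has a
vertex). -/
noncomputable def maxDensity {V : Type*} (G : SimpleGraph V) : ℝ :=
  ⨆ K : G.Subgraph, (K.edgeSet.ncard : ℝ) / (K.verts.ncard : ℝ)

/-- `q` is a threshold function for the graph property `P` in the binomial random graph
`G(n, p)`: if `p = ω(q)` then `P` holds with probability tending to `1`, and if `p = o(q)` then `P`
holds with probability tending to `0`. -/
def IsThreshold (P : ∀ n : ℕ, SimpleGraph (Fin n) → Prop) (q : ℕ → ℝ) : Prop :=
  ∀ p : ℕ → unitInterval,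
    (q =o[atTop] (fun n => (p n : ℝ)) →
      Tendsto (fun n => (SimpleGraph.binomialRandom (Fin n) (p n)).real {G | P n G})
        atTop (𝓝 1)) ∧
    ((fun n => (p n : ℝ)) =o[atTop] q →
      Tendsto (fun n => (SimpleGraph.binomialRandom (Fin n) (p n)).real {G | P n G})
        atTop (𝓝 0))

end VertexGame

/-!
Everything about the game rests on monotonicity: more elements for Maker and more free elements
cannot hurt him (`MakerWinsFrom.map_mono`, which also transports strategies along embeddings of
boards).

*Trees on which Maker wins.* In a complete `N`-ary tree that is deep enough, with `N` larger than
the total number of vertices claimed while Maker makes `|H|` moves, Maker builds the tree `H` leaf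
by leaf: the next vertex of `H` goes to a free child of the image of its neighbour
(`makerWinsFrom_of_embed_tree`).

*Above the threshold.* Let `v` be the number of vertices of `Tmax`. If `p` is much larger than
`n ^ (-v / (v - 1))`, the second moment method gives in `G(n, p)` any fixed number of disjoint
copies of each of the minimal trees, none of which has more than `v` vertices
(`tendsto_binomialRandom_disjoint_forests`). To control disjointness and correlations, every vertex
of every copy is looked for in a vertex class of its own; two potential copies of a tree which agree on
`a ≥ 1` vertices then have at most `a - 1` edges in common. Maker wins by treating the components of
`H` in turn: for each he picks an untouched copy of its minimal tree, and plays there until he has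
won on it. Breaker spoils only boundedly many copies meanwhile (`makerWinsFrom_of_many_boards`).

*Below the threshold.* Let the component `A` of `H` be one whose minimal tree is `Tmax`. A Breaker
who answers in the component of `G(n, p)` where Maker has just moved shows that Maker can only build
the connected graph `A` if he can do so, moving first, on one component alone
(`MakerWinsFrom.exists_class`). By minimality of `Tmax` this component has at least `v` vertices or
is not a tree, so `G(n, p)` contains one of finitely many graphs (`denseGraphs`), the expected
number of copies of each of which tends to zero.
-/

namespace VertexGame

/-! ### Positions and strategies -/

section Game

variable {X Y : Type*} [DecidableEq X] [DecidableEq Y] {b : ℕ} {Win : Finset X → Prop}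
  {t : Player} {M F : Finset X}

theorem makerWinsFrom_maker_iff :
    MakerWinsFrom b Win .maker M F ↔
      (F = ∅ ∧ Win M) ∨ ∃ x ∈ F, MakerWinsFrom b Win .breaker (insert x M) (F.erase x) := by
  constructor
  · intro h
    cases h with
    | finished _ _ hM => exact .inl ⟨rfl, hM⟩
    | makerMove _ _ x hx h => exact .inr ⟨x, hx, h⟩
  · rintro (⟨rfl, h⟩ | ⟨x, hx, h⟩)
    · exact .finished _ _ h
    · exact .makerMove _ _ x hx h

theorem makerWinsFrom_breaker_iff :
    MakerWinsFrom b Win .breaker M F ↔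
      (F = ∅ ∧ Win M) ∨ (F.Nonempty ∧ ∀ S ⊆ F, S.card = min b F.card →
        MakerWinsFrom b Win .maker M (F \ S)) := by
  constructor
  · intro h
    cases h with
    | finished _ _ hM => exact .inl ⟨rfl, hM⟩
    | breakerMove _ _ hF h => exact .inr ⟨hF, h⟩
  · rintro (⟨rfl, h⟩ | ⟨hF, h⟩)
    · exact .finished _ _ h
    · exact .breakerMove _ _ hF h

theorem makerWinsFrom_empty_iff : MakerWinsFrom b Win t M ∅ ↔ Win M := by
  cases t
  · simp [makerWinsFrom_maker_iff]
  · simp [makerWinsFrom_breaker_iff]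

/-- Once every superset of Maker's set is winning, Maker wins whatever is played. The
hypothesis `1 ≤ b` makes the number of free elements decrease with every move. -/
theorem makerWinsFrom_of_win (hb : 1 ≤ b) (F : Finset X) :
    ∀ (t : Player) (M : Finset X), (∀ M', M ⊆ M' → Win M') → MakerWinsFrom b Win t M F := by
  induction F using Finset.strongInduction with
  | H F ih =>
    intro t M hM
    rcases F.eq_empty_or_nonempty with rfl | hF
    · exact .finished _ _ (hM _ subset_rfl)
    cases t with
    | maker =>
      obtain ⟨x, hx⟩ := hF
      exact .makerMove _ _ x hx (ih _ (Finset.erase_ssubset hx) _ _ fun M' h =>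
        hM _ ((Finset.subset_insert _ _).trans h))
    | breaker =>
      refine .breakerMove _ _ hF fun S hS hc => ih _ ?_ _ _ hM
      refine Finset.sdiff_ssubset hS ?_
      rw [← Finset.card_pos, hc]
      exact lt_min hb hF.card_pos

/-- Some winning set consists of elements which Maker owns or can still get. -/
theorem MakerWinsFrom.exists_win (h : MakerWinsFrom b Win t M F) : ∃ N ⊆ M ∪ F, Win N := by
  induction h with
  | finished t M hM => exact ⟨M, by simp, hM⟩
  | makerMove M F x hx h ih =>
    obtain ⟨N, hN, hw⟩ := ih
    refine ⟨N, hN.trans ?_, hw⟩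
    intro y hy
    simp only [Finset.mem_union, Finset.mem_insert, Finset.mem_erase] at hy ⊢
    rcases hy with (rfl | h) | h
    · exact .inr hx
    · exact .inl h
    · exact .inr h.2
  | breakerMove M F hF h ih =>
    obtain ⟨S, hS, hc⟩ := Finset.exists_subset_card_eq (min_le_right b F.card)
    obtain ⟨N, hN, hw⟩ := ih S hS hc
    exact ⟨N, hN.trans (Finset.union_subset_union_right Finset.sdiff_subset), hw⟩

/-- Strategy transfer along an embedding of boards. The target position may be more favourable to
Maker: he may own more elements and more elements may be free. -/
theorem MakerWinsFrom.map_mono (hb : 1 ≤ b) (e : X ↪ Y) {Win' : Finset Y → Prop}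
    (hW : ∀ M M', Win M → M.map e ⊆ M' → Win' M') (h : MakerWinsFrom b Win t M F) :
    ∀ M' F', M.map e ⊆ M' → F.map e ⊆ F' ∪ M' → MakerWinsFrom b Win' t M' F' := by
  induction h with
  | finished t M hM =>
    intro M' F' h1 _
    exact makerWinsFrom_of_win hb _ _ _ fun M'' h => hW _ _ hM (h1.trans h)
  | makerMove M F x hx h ih =>
    intro M' F' h1 h2
    have hmem : e x ∈ F' ∪ M' := h2 (Finset.mem_map_of_mem e hx)
    by_cases hxF : e x ∈ F'
    · refine .makerMove _ _ _ hxF (ih _ _ ?_ ?_)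
      · rw [Finset.map_insert]
        exact Finset.insert_subset_insert _ h1
      · intro y hy
        have := h2 (Finset.map_subset_map.2 (Finset.erase_subset _ _) hy)
        by_cases hyx : y = e x <;> simp_all
    · have hxM : e x ∈ M' := by simpa [hxF] using hmem
      rcases F'.eq_empty_or_nonempty with rfl | ⟨y, hy⟩
      · obtain ⟨N, hN, hw⟩ := (MakerWinsFrom.makerMove M F x hx h).exists_win
        refine .finished _ _ (hW _ _ hw ((Finset.map_subset_map.2 hN).trans ?_))
        rw [Finset.map_union]
        exact Finset.union_subset h1 (by simpa using h2)
      · refine .makerMove _ _ y hy (ih _ _ ?_ ?_)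
        · rw [Finset.map_insert]
          exact Finset.insert_subset (Finset.mem_insert_of_mem hxM)
            (h1.trans (Finset.subset_insert _ _))
        · intro z hz
          have := h2 (Finset.map_subset_map.2 (Finset.erase_subset _ _) hz)
          by_cases hyx : z = y <;> simp_all
  | breakerMove M F hF h ih =>
    intro M' F' h1 h2
    rcases F'.eq_empty_or_nonempty with rfl | hF'
    · obtain ⟨N, hN, hw⟩ := (MakerWinsFrom.breakerMove M F hF h).exists_win
      refine .finished _ _ (hW _ _ hw ((Finset.map_subset_map.2 hN).trans ?_))
      rw [Finset.map_union]
      exact Finset.union_subset h1 (by simpa using h2)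
    · refine .breakerMove _ _ hF' fun S' hS' hc' => ?_
      have hcard : (F.filter (e · ∈ S')).card ≤ min b F.card := by
        refine le_min ?_ (Finset.card_filter_le _ _)
        calc (F.filter (e · ∈ S')).card = ((F.filter (e · ∈ S')).map e).card := by simp
          _ ≤ S'.card := Finset.card_le_card (by intro y; simp; grind)
          _ ≤ b := hc' ▸ min_le_left _ _
      obtain ⟨S, hS1, hS2, hc⟩ := Finset.exists_subsuperset_card_eq
        (Finset.filter_subset (e · ∈ S') F) hcard (min_le_right _ _)
      refine ih S hS2 hc _ _ h1 ?_
      intro y hy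
      obtain ⟨x, hx, rfl⟩ := Finset.mem_map.1 hy
      have hxF := (Finset.mem_sdiff.1 hx).1
      have := h2 (Finset.mem_map_of_mem e hxF)
      have hxS : e x ∉ S' := fun hh =>
        (Finset.mem_sdiff.1 hx).2 (hS1 (Finset.mem_filter.2 ⟨hxF, hh⟩))
      simp_all

theorem MakerWinsFrom.mono (hb : 1 ≤ b) (hW : Monotone Win) (h : MakerWinsFrom b Win t M F)
    {M' F' : Finset X} (hM : M ⊆ M') (hF : F ⊆ F') : MakerWinsFrom b Win t M' F' :=
  h.map_mono hb (.refl X) (fun M M' hM h => hW (by simpa using h) hM) _ _ (by simpa using hM)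
    (by simpa using hF.trans Finset.subset_union_left)

/-- Breaker's opening move is no help to Maker. -/
theorem MakerWinsFrom.maker_of_breaker (hb : 1 ≤ b) (hW : Monotone Win)
    (h : MakerWinsFrom b Win .breaker M F) : MakerWinsFrom b Win .maker M F := by
  rcases makerWinsFrom_breaker_iff.1 h with ⟨rfl, h'⟩ | ⟨_, h⟩
  · exact .finished _ _ h'
  · obtain ⟨S, hS, hc⟩ := Finset.exists_subset_card_eq (min_le_right b F.card)
    exact (h S hS hc).mono hb hW subset_rfl Finset.sdiff_subset

/-- The converse of strategy transfer: a strategy on the image of a board gives one on the board. -/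
theorem MakerWinsFrom.of_map (e : X ↪ Y) {Win' : Finset Y → Prop}
    (hW : ∀ M, Win' (M.map e) → Win M) {M' F' : Finset Y}
    (h : MakerWinsFrom b Win' t M' F') :
    ∀ M F, M' = M.map e → F' = F.map e → MakerWinsFrom b Win t M F := by
  induction h with
  | finished t M hM =>
    rintro M F rfl h2
    obtain rfl : F = ∅ := by simpa using h2.symm
    exact .finished _ _ (hW _ hM)
  | makerMove M' F' x hx h ih =>
    rintro M F rfl rfl
    obtain ⟨y, hy, rfl⟩ := Finset.mem_map.1 hx
    exact .makerMove _ _ y hy (ih _ _ (by simp [Finset.map_insert]) (by simp [Finset.map_erase]))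
  | breakerMove M' F' hF h ih =>
    rintro M F rfl rfl
    refine .breakerMove _ _ (by simpa using hF) fun S hS hc => ?_
    refine ih (S.map e) (Finset.map_subset_map.2 hS) (by simpa using hc) _ _ rfl ?_
    ext y
    simp only [Finset.mem_sdiff, Finset.mem_map]
    grind [e.injective.eq_iff]

/-- If the board is partitioned into classes and every winning set of Maker contains a winning set
for one of the classes inside that class, then Maker, moving first, can only win if he wins,
moving first, on one of the classes alone: otherwise Breaker answers each move of Maker inside the
class where it was made. -/
theorem MakerWinsFrom.exists_class (hb : 1 ≤ b) {ι : Type*} [DecidableEq ι] (c : X → ι)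
    (Wc : ι → Finset X → Prop) (hmono : ∀ i, Monotone (Wc i))
    (hWin : ∀ M, Win M → ∃ i, Wc i (M.filter (c · = i))) (F : Finset X) :
    ∀ M, MakerWinsFrom b Win .maker M F →
      ∃ i, MakerWinsFrom b (Wc i) .maker (M.filter (c · = i)) (F.filter (c · = i)) := by
  induction F using Finset.strongInduction with
  | H F ih =>
    intro M h
    rcases makerWinsFrom_maker_iff.1 h with ⟨rfl, h'⟩ | ⟨x, hx, h⟩
    · obtain ⟨i, hi⟩ := hWin _ h'
      exact ⟨i, by simpa using MakerWinsFrom.finished _ _ hi⟩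
    by_contra! hcon
    have herase : (F.erase x).filter (c · = c x) = (F.filter (c · = c x)).erase x := by
      ext y; simp; tauto
    have hins : (insert x M).filter (c · = c x) = insert x (M.filter (c · = c x)) := by
      ext y; simp; grind
    have hins' : ∀ j, j ≠ c x → (insert x M).filter (c · = j) = M.filter (c · = j) := by
      intro j hj; ext y; simp; grind
    have hbr : ¬ MakerWinsFrom b (Wc (c x)) .breaker ((insert x M).filter (c · = c x))
        ((F.erase x).filter (c · = c x)) := by
      intro hh
      rw [hins, herase] at hh
      exact hcon _ (.makerMove _ _ x (by simp [hx]) hh)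
    rcases makerWinsFrom_breaker_iff.1 h with ⟨hF, h⟩ | ⟨hF, h⟩
    · obtain ⟨i, hi⟩ := hWin _ h
      by_cases hix : i = c x
      · subst hix
        exact hbr (by rw [hF]; simpa using MakerWinsFrom.finished _ _ hi)
      · have h0 : F.filter (c · = i) = ∅ := by
          ext y
          have : y ∉ F.erase x := by simp [hF]
          simp; grind
        rw [hins' i hix] at hi
        exact hcon i (by rw [h0]; exact .finished _ _ hi)
    · -- Breaker's answer inside the class of `x`, then completed arbitrarily to a full move.
      obtain ⟨S₀, hS₀, hc₀, hbad⟩ : ∃ S₀ ⊆ (F.erase x).filter (c · = c x), S₀.card ≤ b ∧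
          ¬ MakerWinsFrom b (Wc (c x)) .maker ((insert x M).filter (c · = c x))
            ((F.erase x).filter (c · = c x) \ S₀) := by
        rw [makerWinsFrom_breaker_iff] at hbr
        push Not at hbr
        rcases ((F.erase x).filter (c · = c x)).eq_empty_or_nonempty with h0 | h0
        · refine ⟨∅, by simp, by simp, ?_⟩
          rw [h0, Finset.sdiff_empty, makerWinsFrom_empty_iff]
          exact hbr.1 h0
        · obtain ⟨S, hS, hc, hn⟩ := hbr.2 h0
          exact ⟨S, hS, hc ▸ min_le_left _ _, hn⟩
      have hS₀' : S₀ ⊆ F.erase x := hS₀.trans (Finset.filter_subset _ _)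
      obtain ⟨S, hS1, hS2, hc⟩ := Finset.exists_subsuperset_card_eq hS₀'
        (le_min hc₀ (Finset.card_le_card hS₀')) (min_le_right b _)
      obtain ⟨j, hj⟩ := ih (F.erase x \ S)
        (Finset.sdiff_subset.trans_ssubset (Finset.erase_ssubset hx)) _ (h S hS2 hc)
      by_cases hjx : j = c x
      · subst hjx
        refine hbad (hj.mono hb (hmono _) subset_rfl ?_)
        intro y; simp; grind
      · rw [hins' j hjx] at hj
        refine hcon j (hj.mono hb (hmono _) subset_rfl ?_)
        intro y; simp; grind

/-- If Maker wins moving first even after losing any `b` free elements, then he wins moving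
second. -/
theorem makerWinsFrom_breaker_of_forall
    (h : ∀ F' ⊆ F, (F \ F').card ≤ b → MakerWinsFrom b Win .maker M F') :
    MakerWinsFrom b Win .breaker M F := by
  rcases F.eq_empty_or_nonempty with rfl | hF
  · exact .finished _ _ (makerWinsFrom_empty_iff.1 (h ∅ subset_rfl (by simp)))
  · refine .breakerMove _ _ hF fun S hS hc => h _ Finset.sdiff_subset ?_
    rw [Finset.sdiff_sdiff_eq_self hS, hc]
    exact min_le_left _ _

/-- Maker plays a strategy on a sub-board `B` of the free elements until he has won there; on the
way Breaker claims at most `b * |B|` elements outside `B`. -/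
theorem MakerWinsFrom.then_continue (hb : 1 ≤ b) {Win₁ : Finset X → Prop} {M₁ B : Finset X}
    (h : MakerWinsFrom b Win₁ t M₁ B) :
    ∀ M F, M₁ ⊆ M → B ⊆ F →
      (∀ t' M' F' N, N ⊆ M' → N ⊆ M₁ ∪ B → Win₁ N → M ⊆ M' → F' ⊆ F →
        ((F \ B) \ F').card ≤ b * B.card → MakerWinsFrom b Win t' M' F') →
      MakerWinsFrom b Win t M F := by
  induction h with
  | finished t M₁ hM =>
    intro M F h1 _ hcont
    exact hcont _ _ _ M₁ h1 (by simp) hM subset_rfl subset_rfl (by simp)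
  | makerMove M₁ B x hx h ih =>
    intro M F h1 h2 hcont
    refine .makerMove _ _ x (h2 hx) (ih _ _ (Finset.insert_subset_insert _ h1)
      (Finset.erase_subset_erase _ h2) fun t' M' F' N hN hN' hw hM' hF' hc => ?_)
    refine hcont t' M' F' N hN ?_ hw ((Finset.subset_insert _ _).trans hM')
      (hF'.trans (Finset.erase_subset _ _)) ?_
    · refine hN'.trans ?_
      intro y; simp; grind
    · have : (F \ B) \ F' = ((F.erase x) \ (B.erase x)) \ F' := by
        ext y; simp; grind
      rw [this]
      exact hc.trans (Nat.mul_le_mul_left _ (Finset.card_le_card (Finset.erase_subset _ _)))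
  | breakerMove M₁ B hB h ih =>
    intro M F h1 h2 hcont
    refine .breakerMove _ _ (hB.mono h2) fun S hS hSc => ?_
    have hcard : (B ∩ S).card ≤ min b B.card :=
      le_min ((Finset.card_le_card Finset.inter_subset_right).trans (hSc ▸ min_le_left _ _))
        (Finset.card_le_card Finset.inter_subset_left)
    obtain ⟨S₁, hS1, hS2, hc₁⟩ := Finset.exists_subsuperset_card_eq
      (Finset.inter_subset_left (s₁ := B) (s₂ := S)) hcard (min_le_right _ _)
    refine ih S₁ hS2 hc₁ _ _ h1 ?_ fun t' M' F' N hN hN' hw hM' hF' hc => ?_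
    · intro y hy
      have := Finset.mem_sdiff.1 hy
      exact Finset.mem_sdiff.2 ⟨h2 this.1, fun hyS => this.2 (hS1 (by simp [this.1, hyS]))⟩
    · refine hcont t' M' F' N hN (hN'.trans
        (Finset.union_subset_union_right Finset.sdiff_subset)) hw hM'
        (hF'.trans Finset.sdiff_subset) ?_
      have hsub : (F \ B) \ F' ⊆ S ∪ (((F \ S) \ (B \ S₁)) \ F') := by
        intro y; simp; grind
      have hS₁pos : 1 ≤ S₁.card := hc₁ ▸ le_min hb hB.card_pos
      have hBS : (B \ S₁).card + 1 ≤ B.card := by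
        rw [Finset.card_sdiff_of_subset hS2]
        have := Finset.card_le_card hS2
        omega
      calc ((F \ B) \ F').card ≤ S.card + (((F \ S) \ (B \ S₁)) \ F').card :=
            (Finset.card_le_card hsub).trans (Finset.card_union_le _ _)
        _ ≤ b + b * (B \ S₁).card := Nat.add_le_add (hSc ▸ min_le_left _ _) hc
        _ = b * ((B \ S₁).card + 1) := by ring
        _ ≤ b * B.card := Nat.mul_le_mul_left _ hBS

/-- When the free set shrinks from `F` to `F'`, each lost element spoils at most one of the disjoint
sub-boards. -/
theorem card_filter_subset_le {κ : Type*} [Fintype κ] (Bd : κ → Finset X)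
    (hdisj : Pairwise fun c d => Disjoint (Bd c) (Bd d)) (F F' : Finset X) :
    (Finset.univ.filter fun c => Bd c ⊆ F).card ≤
      (Finset.univ.filter fun c => Bd c ⊆ F').card + (F \ F').card := by
  classical
  have hsub : (Finset.univ.filter fun c => Bd c ⊆ F) ⊆
      (Finset.univ.filter fun c => Bd c ⊆ F') ∪
        (Finset.univ.filter fun c => Bd c ⊆ F ∧ ¬ Bd c ⊆ F') := by
    intro c; simp; tauto
  refine (Finset.card_le_card hsub).trans ((Finset.card_union_le _ _).trans ?_)
  refine Nat.add_le_add_left ?_ _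
  refine Finset.card_le_card_of_forall_subsingleton (fun c x => x ∈ Bd c) ?_ ?_
  · intro c hc
    have hc' : Bd c ⊆ F ∧ ¬ Bd c ⊆ F' := by simpa using hc
    obtain ⟨x, hx, hx'⟩ := Finset.not_subset.1 hc'.2
    exact ⟨x, by simp [hc'.1 hx, hx'], hx⟩
  · rintro x - c ⟨-, hc⟩ d ⟨-, hd⟩
    by_contra hne
    exact Finset.disjoint_left.1 (hdisj hne) hc hd

/-- Maker achieves several goals in turn, each on an untouched sub-board: it suffices that each goal
`i ∈ I` has sufficiently many disjoint sub-boards of bounded size on which Maker wins moving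
first. -/
theorem makerWinsFrom_of_many_boards (hb : 1 ≤ b) {ι κ : Type*} [DecidableEq ι] [Fintype κ]
    (Wg : ι → Finset X → Prop) (Bd : ι → κ → Finset X) (s : ℕ)
    (hdisj : ∀ i c j d, (i, c) ≠ (j, d) → Disjoint (Bd i c) (Bd j d))
    (hs : ∀ i c, (Bd i c).card ≤ s)
    (hwin : ∀ i c, MakerWinsFrom b (Wg i) .maker ∅ (Bd i c)) (I : Finset ι) :
    ∀ t M F, (∀ i ∈ I, I.card * (b * s + b) <
        (Finset.univ.filter fun c => Bd i c ⊆ F).card) →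
      (∀ M', M ⊆ M' → (∀ i ∈ I, ∃ N ⊆ M', (∃ c, N ⊆ Bd i c) ∧ Wg i N) → Win M') →
      MakerWinsFrom b Win t M F := by
  have hdisj' : ∀ i, Pairwise fun c d => Disjoint (Bd i c) (Bd i d) :=
    fun i c d h => hdisj i c i d (by simpa using h)
  induction I using Finset.induction_on with
  | empty =>
    intro t M F _ hw
    exact makerWinsFrom_of_win hb _ _ _ fun M' h => hw M' h (by simp)
  | insert i I hi ih =>
    intro t M F hcnt hw
    -- Reduce to the case where Maker is to move, with a slightly weaker count.
    suffices hmaker : ∀ F, (∀ j ∈ insert i I, I.card * (b * s + b) + b * s <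
        (Finset.univ.filter fun c => Bd j c ⊆ F).card) → MakerWinsFrom b Win .maker M F by
      cases t with
      | maker =>
        refine hmaker F fun j hj => lt_of_le_of_lt ?_ (hcnt j hj)
        rw [Finset.card_insert_of_notMem hi, Nat.add_mul]
        omega
      | breaker =>
        refine makerWinsFrom_breaker_of_forall fun F' _ hc => hmaker F' fun j hj => ?_
        have h1 := hcnt j hj
        have h2 := card_filter_subset_le (Bd j) (hdisj' j) F F'
        rw [Finset.card_insert_of_notMem hi, Nat.add_mul] at h1
        omega
    intro F hcnt
    have hpos : 0 < (Finset.univ.filter fun c => Bd i c ⊆ F).card :=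
      (Nat.zero_le _).trans_lt (hcnt i (by simp))
    obtain ⟨c, hc⟩ := Finset.card_pos.1 hpos
    have hcF : Bd i c ⊆ F := by simpa using hc
    refine (hwin i c).then_continue hb M F (by simp) hcF
      fun t' M' F' N hN hN' hwN hM' hF' hcard => ih t' M' F' (fun j hj => ?_) ?_
    · have h1 := hcnt j (by simp [hj])
      have hji : j ≠ i := fun h => hi (h ▸ hj)
      have heq : (Finset.univ.filter fun d => Bd j d ⊆ F \ Bd i c) =
          Finset.univ.filter fun d => Bd j d ⊆ F := by
        ext d
        simp only [Finset.mem_filter, Finset.mem_univ, true_and, Finset.subset_sdiff]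
        exact and_iff_left (hdisj j d i c (by simp [hji]))
      have h2 := card_filter_subset_le (Bd j) (hdisj' j) (F \ Bd i c) F'
      rw [heq] at h2
      have h3 : b * (Bd i c).card ≤ b * s := Nat.mul_le_mul_left _ (hs i c)
      omega
    · intro M'' hM'' hall
      refine hw M'' (hM'.trans hM'') fun j hj => ?_
      rcases Finset.mem_insert.1 hj with rfl | hj
      · exact ⟨N, hN.trans hM'', ⟨c, by simpa using hN'⟩, hwN⟩
      · exact hall j hj

end Game

/-! ### Building a tree greedily -/

section Greedy

variable {X : Type*} [DecidableEq X] {b : ℕ} {Win : Finset X → Prop}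

/-- Whoever is to move, Maker's next move can be in a set `A` that is too large for all of it to be
claimed by then; `F'` is the free set when Maker makes this move. -/
theorem makerWinsFrom_of_claim [Fintype X] {M F A : Finset X}
    (hA : (Finset.univ \ F).card + b < A.card)
    (h : ∀ y ∈ A, ∀ F' ⊆ F, y ∈ F' → (F \ F').card ≤ b →
      MakerWinsFrom b Win .breaker (insert y M) (F'.erase y)) (t : Player) :
    MakerWinsFrom b Win t M F := by
  suffices hmaker : ∀ F' ⊆ F, (F \ F').card ≤ b → MakerWinsFrom b Win .maker M F' by
    cases t with
    | maker => exact hmaker F subset_rfl (by simp)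
    | breaker => exact makerWinsFrom_breaker_of_forall hmaker
  intro F' hF' hc
  obtain ⟨y, hy, hyF⟩ : ∃ y ∈ A, y ∉ (Finset.univ \ F) ∪ (F \ F') := by
    apply Finset.exists_mem_notMem_of_card_lt_card
    exact (Finset.card_union_le _ _).trans_lt (by omega)
  have hyF' : y ∈ F' := by simp at hyF; tauto
  exact .makerMove _ _ y hyF' (h y hy F' hF' hyF' hc)

/-- On a graph with levels in which every vertex below level `D` has at least `N` neighbours one
level up, Maker can build a copy of any tree with at most `D` vertices greedily, leaf by leaf, as
long as the total number of claimed vertices does not reach `N`. The game may then go on from any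
position in which such a copy has been claimed. -/
theorem makerWinsFrom_of_embed_tree [Fintype X] (G : SimpleGraph X) [DecidableRel G.Adj]
    (lev : X → ℕ) (N D : ℕ)
    (hchild : ∀ x, lev x < D →
      N ≤ (Finset.univ.filter fun y => G.Adj x y ∧ lev y = lev x + 1).card)
    (hroot : N ≤ (Finset.univ.filter fun x => lev x ≤ 1).card) (n : ℕ) :
    ∀ {V : Type*} [Fintype V] (H : SimpleGraph V), Fintype.card V = n → H.IsTree → n ≤ D →
      n * (b + 1) ≤ N → ∀ t : Player,
      (∀ t' M' F', Disjoint M' F' → (Finset.univ \ F').card ≤ n * (b + 1) →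
        ∀ φ : V → X, Function.Injective φ → (∀ v, φ v ∈ M') →
          (∀ u v, H.Adj u v → G.Adj (φ u) (φ v)) → (∀ v, lev (φ v) ≤ n) →
          MakerWinsFrom b Win t' M' F') →
      MakerWinsFrom b Win t ∅ Finset.univ := by
  have hstep : ∀ F F' : Finset X, ∀ y, ∀ k, F' ⊆ F → (F \ F').card ≤ b →
      (Finset.univ \ F).card ≤ k * (b + 1) →
      (Finset.univ \ F'.erase y).card ≤ (k + 1) * (b + 1) := by
    intro F F' y k hF' hc hk
    have : Finset.univ \ F'.erase y ⊆ insert y ((Finset.univ \ F) ∪ (F \ F')) := by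
      intro z; simp; tauto
    calc _ ≤ _ := Finset.card_le_card this
      _ ≤ ((Finset.univ \ F) ∪ (F \ F')).card + 1 := Finset.card_insert_le _ _
      _ ≤ (Finset.univ \ F).card + (F \ F').card + 1 := by
        gcongr; exact Finset.card_union_le _ _
      _ ≤ _ := by rw [Nat.add_mul]; omega
  induction n with
  | zero =>
    intro V _ H hV hH
    have := hH.connected.nonempty
    exact absurd hV Fintype.card_ne_zero
  | succ n ih =>
    intro V _ H hV hH hD hN t hcont
    rw [Nat.add_mul] at hN
    rcases Nat.eq_zero_or_pos n with rfl | hn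
    · have hsub : Subsingleton V := Fintype.card_le_one_iff_subsingleton.1 hV.le
      refine makerWinsFrom_of_claim (A := Finset.univ.filter fun x => lev x ≤ 1)
        (by simp; omega) (fun y hy F' hF' hyF' hc => ?_) t
      refine hcont _ _ _ (by simp) (hstep Finset.univ F' y 0 hF' hc (by simp)) (fun _ => y)
        (Function.injective_of_subsingleton _) (by simp) ?_
        (fun _ => by simpa using hy)
      intro u v huv
      exact absurd (Subsingleton.elim u v) huv.ne
    · have hnt : Nontrivial V := Fintype.one_lt_card_iff_nontrivial.1 (by omega)
      classical
      obtain ⟨v, hv⟩ := hH.exists_vert_degree_one_of_nontrivial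
      have hconn := hH.connected.induce_compl_singleton_of_degree_eq_one hv
      obtain ⟨u, huv, huniq⟩ := SimpleGraph.degree_eq_one_iff_existsUnique_adj.1 hv
      have hu : u ∈ ({v}ᶜ : Set V) := by simpa using huv.ne'
      refine ih (H.induce {v}ᶜ) ?_ ⟨hconn, hH.isAcyclic.induce _⟩ (by omega) (by omega) t ?_
      · rw [Fintype.card_compl_set, hV]; simp
      intro t' M' F' hdisj hcard φ hφ hφM hφG hφl
      have hlu := hφl ⟨u, hu⟩
      refine makerWinsFrom_of_claim
        (A := Finset.univ.filter fun y => G.Adj (φ ⟨u, hu⟩) y ∧ lev y = lev (φ ⟨u, hu⟩) + 1)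
        ?_ (fun y hy F'' hF'' hyF'' hc => ?_) t'
      · have := hchild (φ ⟨u, hu⟩) (by omega)
        omega
      have hy' : G.Adj (φ ⟨u, hu⟩) y ∧ lev y = lev (φ ⟨u, hu⟩) + 1 := by simpa using hy
      have hyM : y ∉ M' := fun h => Finset.disjoint_left.1 hdisj h (hF'' hyF'')
      have hne : ∀ x, φ x ≠ y := fun x h => hyM (h ▸ hφM x)
      refine hcont _ _ _ ?_ (hstep F' F'' y n hF'' hc hcard)
        (fun x => if hx : x = v then y else φ ⟨x, hx⟩) ?_ ?_ ?_ ?_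
      · rw [Finset.disjoint_insert_left]
        exact ⟨by simp, (hdisj.mono_right hF'').mono_right (Finset.erase_subset _ _)⟩
      · intro x x' hxx
        by_cases hx : x = v <;> by_cases hx' : x' = v <;>
          simp only [hx, hx', dite_true, dite_false] at hxx ⊢
        · exact absurd hxx.symm (hne _)
        · exact absurd hxx (hne _)
        · exact congrArg Subtype.val (hφ hxx)
      · intro x
        by_cases hx : x = v <;> simp [hx, hφM]
      · intro x x' hxx
        by_cases hx : x = v
        · subst hx
          obtain rfl := huniq _ hxx
          simpa [hxx.ne'] using hy'.1.symm
        · by_cases hx' : x' = v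
          · subst hx'
            obtain rfl := huniq _ hxx.symm
            simpa [hxx.ne] using hy'.1
          · simpa [hx, hx'] using hφG ⟨x, hx⟩ ⟨x', hx'⟩ hxx
      · intro x
        by_cases hx : x = v
        · simp only [hx, dite_true]; omega
        · simp only [hx, dite_false]
          exact (hφl _).trans (Nat.le_succ _)

end Greedy

/-! ### The complete `N`-ary tree as a board -/

section TreeBoard

/-- The complete `N`-ary tree of depth `D`: its vertices are the words of length at most `D` over
an alphabet with `N` letters, a word being joined to its one-letter extensions (on the left). -/
def completeTree (N D : ℕ) : SimpleGraph {l : List (Fin N) // l.length ≤ D} where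
  Adj l l' := (∃ a, l'.1 = a :: l.1) ∨ ∃ a, l.1 = a :: l'.1
  symm := ⟨fun _ _ h => h.symm⟩
  loopless := ⟨fun l h => by
    rcases h with ⟨a, h⟩ | ⟨a, h⟩ <;> simpa using congrArg List.length h⟩

instance (N D : ℕ) : Finite {l : List (Fin N) // l.length ≤ D} :=
  (List.finite_length_le (Fin N) D).to_subtype

theorem completeTree_isTree (N D : ℕ) : (completeTree N D).IsTree := by
  rw [SimpleGraph.isTree_iff_connected_and_card]
  let r : {l : List (Fin N) // l.length ≤ D} := ⟨[], by simp⟩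
  have hreach : ∀ (l : List (Fin N)) (hl : l.length ≤ D),
      (completeTree N D).Reachable ⟨l, hl⟩ r := by
    intro l
    induction l with
    | nil => intro hl; exact .refl _
    | cons a l ih =>
      intro hl
      have hl' : l.length ≤ D := by simp at hl; omega
      have hadj : (completeTree N D).Adj ⟨a :: l, hl⟩ ⟨l, hl'⟩ := .inr ⟨a, rfl⟩
      exact hadj.reachable.trans (ih hl')
  have hconn : (completeTree N D).Connected := by
    rw [SimpleGraph.connected_iff]
    exact ⟨fun x y => (hreach x.1 x.2).trans (hreach y.1 y.2).symm, ⟨r⟩⟩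
  refine ⟨hconn, le_antisymm ?_ hconn.card_vert_le_card_edgeSet_add_one⟩
  have htail : ∀ x : {x // x ≠ r}, (x.1.1.tail).length ≤ D := fun x => by
    have := x.1.2; simp; omega
  -- Every edge joins a nonempty word to its tail, so there are fewer edges than vertices.
  let f : {x // x ≠ r} → (completeTree N D).edgeSet := fun x =>
    ⟨s(x.1, ⟨x.1.1.tail, htail x⟩), by
      obtain ⟨⟨l, hl⟩, hx⟩ := x
      cases l with
      | nil => exact absurd rfl hx
      | cons a l => exact .inr ⟨a, rfl⟩⟩
  have hf : Function.Surjective f := by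
    rintro ⟨e, he⟩
    induction e using Sym2.ind with
    | _ x y =>
      rcases he with ⟨a, h⟩ | ⟨a, h⟩
      · refine ⟨⟨y, fun hy => by simp [hy, r] at h⟩, ?_⟩
        apply Subtype.ext
        simp only [f]
        rw [Sym2.eq_swap]
        congr 2
        exact congrArg List.tail h
      · refine ⟨⟨x, fun hy => by simp [hy, r] at h⟩, ?_⟩
        apply Subtype.ext
        simp only [f]
        congr 2
        exact congrArg List.tail h
  have h1 := Nat.card_le_card_of_surjective f hf
  have := Fintype.ofFinite {l : List (Fin N) // l.length ≤ D}
  classical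
  have h2 : Nat.card {x // x ≠ r} + 1 = Nat.card {l : List (Fin N) // l.length ≤ D} := by
    rw [Nat.card_eq_fintype_card, Nat.card_eq_fintype_card, Fintype.card_subtype_compl]
    have : 0 < Fintype.card {l : List (Fin N) // l.length ≤ D} := Fintype.card_pos_iff.2 ⟨r⟩
    simp; omega
  omega

/-- A winning strategy for the board `G` can be played in a graph containing a copy of `G`, on the
vertices of this copy. -/
theorem MakerWins.of_copy {U V W : Type*} [Fintype V] [DecidableEq V] [Fintype W] [DecidableEq W]
    {b : ℕ} (hb : 1 ≤ b) {t : Player} {A : SimpleGraph U} {G : SimpleGraph V} {K : SimpleGraph W}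
    (e : V ↪ W) (he : ∀ u v, G.Adj u v → K.Adj (e u) (e v))
    (h : MakerWins b t A G) :
    MakerWinsFrom b (fun M : Finset W => A.IsContained (K.induce (M : Set W))) t ∅
      (Finset.univ.map e) := by
  refine h.map_mono hb e (fun M M' hA hM => hA.trans ?_) _ _ (by simp) (by simp)
  exact ⟨⟨⟨fun x => ⟨e x.1, hM (Finset.mem_map_of_mem e x.2)⟩, fun {x y} hxy => he _ _ hxy⟩,
    fun x y hxy => Subtype.ext (e.injective (congrArg Subtype.val hxy))⟩⟩

theorem exists_isTree_makerWins {V : Type*} [Fintype V] (H : SimpleGraph V) (hH : H.IsTree)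
    {b : ℕ} (hb : 1 ≤ b) :
    ∃ (m : ℕ) (T : SimpleGraph (Fin m)), T.IsTree ∧
      ∀ first : Player, MakerWins b first H T := by
  classical
  set n := Fintype.card V with hn
  set N := n * (b + 1)
  have := Fintype.ofFinite {l : List (Fin N) // l.length ≤ n}
  let e := Fintype.equivFin {l : List (Fin N) // l.length ≤ n}
  let hiso := SimpleGraph.Iso.map e (completeTree N n)
  refine ⟨_, (completeTree N n).map e.toEmbedding, hiso.isTree_iff.1 (completeTree_isTree N n),
    fun t => ?_⟩
  suffices h : MakerWins b t H (completeTree N n) by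
    have := MakerWins.of_copy (K := (completeTree N n).map e.toEmbedding) hb e.toEmbedding
      (fun u v huv => hiso.map_adj_iff.2 huv) h
    simpa [MakerWins] using this
  have hnpos : 1 ≤ n := by
    have := hH.connected.nonempty
    exact Fintype.card_pos
  refine makerWinsFrom_of_embed_tree (completeTree N n) (fun l => l.1.length) N n ?_ ?_ n H hn.symm
    hH le_rfl le_rfl t ?_
  · rintro ⟨l, hl⟩ hlt
    have hlt' : l.length < n := hlt
    let f : Fin N → {l : List (Fin N) // l.length ≤ n} := fun a => ⟨a :: l, by simp; omega⟩
    have hf : Function.Injective f := fun a a' h => by simpa [f] using h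
    calc N = (Finset.univ.image f).card := by rw [Finset.card_image_of_injective _ hf]; simp
      _ ≤ _ := Finset.card_le_card ?_
    intro y hy
    obtain ⟨a, -, rfl⟩ := Finset.mem_image.1 hy
    simp only [Finset.mem_filter, Finset.mem_univ, true_and]
    exact ⟨.inl ⟨a, rfl⟩, by simp [f]⟩
  · let f : Fin N → {l : List (Fin N) // l.length ≤ n} := fun a => ⟨[a], by simpa using hnpos⟩
    have hf : Function.Injective f := fun a a' h => by simpa [f] using h
    calc N = (Finset.univ.image f).card := by rw [Finset.card_image_of_injective _ hf]; simp
      _ ≤ _ := Finset.card_le_card ?_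
    intro y hy
    obtain ⟨a, -, rfl⟩ := Finset.mem_image.1 hy
    simp [f]
  · intro t' M F _ _ φ hφ hφM hφG _
    refine makerWinsFrom_of_win hb _ _ _ fun M' hM' => ?_
    exact ⟨⟨⟨fun x => ⟨φ x, hM' (hφM x)⟩, fun {x y} hxy => hφG _ _ hxy⟩,
      fun x y hxy => hφ (congrArg Subtype.val hxy)⟩⟩

end TreeBoard

/-! ### Moment bounds for the binomial random graph -/

section Probability

open MeasureTheory SimpleGraph

instance {V : Type*} [Finite V] : DiscreteMeasurableSpace (SimpleGraph V) where
  forall_measurableSet s := by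
    rw [← Set.preimage_image_eq s (edgeSet_injective (V := V))]
    exact measurable_edgeSet (Set.toFinite _).measurableSet

theorem binomialRandom_real_subset_edgeSet {V : Type*} [Finite V] (p : unitInterval)
    (S : Finset (Sym2 V)) (hS : ∀ e ∈ S, ¬ e.IsDiag) :
    (binomialRandom V p).real {G | (S : Set (Sym2 V)) ⊆ G.edgeSet} = (p : ℝ) ^ S.card := by
  have h1 : (binomialRandom V p) {G | (S : Set (Sym2 V)) ⊆ G.edgeSet} =
      ENNReal.ofNNReal (unitInterval.toNNReal p) ^ S.card := by
    rw [binomialRandom_eq_map, Measure.map_apply measurable_fromEdgeSet (.of_discrete),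
      ProbabilityTheory.setBernoulli_apply']
    have : ((fun q : Sym2 V → Prop => {i | q i}) ⁻¹' (fromEdgeSet ⁻¹'
        {G | (S : Set (Sym2 V)) ⊆ G.edgeSet})) = Set.pi S (fun _ => {True}) := by
      ext f
      simp only [Set.mem_preimage, Set.mem_ofPred_eq, edgeSet_fromEdgeSet, Set.mem_pi,
        Set.mem_singleton_iff, eq_iff_iff, iff_true, Set.subset_def, Set.mem_sdiff]
      exact ⟨fun h e he => (h e he).1, fun h e he => ⟨h e he, hS e he⟩⟩
    rw [this, Measure.infinitePi_pi _ (fun _ _ => .of_discrete)]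
    rw [Finset.prod_congr rfl (g := fun _ => ENNReal.ofNNReal (unitInterval.toNNReal p)),
      Finset.prod_const]
    intro e he
    simp [hS e he]
  rw [measureReal_def, h1]
  simp

/-- The second moment method for a family of events of equal probability: the probability that
none of them occurs is at most the average excess correlation. -/
theorem measureReal_forall_notMem_le {Ω ι : Type*} [MeasurableSpace Ω] [Finite Ω]
    [DiscreteMeasurableSpace Ω] (μ : Measure Ω) [IsProbabilityMeasure μ] [Fintype ι] [Nonempty ι]
    (E : ι → Set Ω) {q : ℝ} (hq : 0 < q) (hE : ∀ f, μ.real (E f) = q) (r : ι → ι → ℝ)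
    (hr : ∀ f g, μ.real (E f ∩ E g) ≤ q ^ 2 * (1 + r f g)) :
    μ.real {ω | ∀ f, ω ∉ E f} ≤ (∑ f, ∑ g, r f g) / (Fintype.card ι : ℝ) ^ 2 := by
  set N : ℝ := (Fintype.card ι : ℝ) with hN
  have hNpos : 0 < N := by rw [hN]; exact_mod_cast Fintype.card_pos
  let Z : ι → Ω → ℝ := fun f => (E f).indicator 1
  have hint : ∀ h : Ω → ℝ, Integrable h μ := fun h => .of_finite
  have hZ : ∀ f, ∫ ω, Z f ω ∂μ = q := fun f => by
    rw [integral_indicator_one .of_discrete, hE]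
  have hZZ : ∀ f g, ∫ ω, Z f ω * Z g ω ∂μ = μ.real (E f ∩ E g) := fun f g => by
    rw [← integral_indicator_one .of_discrete]
    congr 1; ext ω
    by_cases h : ω ∈ E f <;> by_cases h' : ω ∈ E g <;> simp [Z, h, h']
  have hvar : ∫ ω, (∑ f, Z f ω - N * q) ^ 2 ∂μ =
      ∑ f, ∑ g, μ.real (E f ∩ E g) - (N * q) ^ 2 := by
    have h1 : ∀ ω, (∑ f, Z f ω - N * q) ^ 2 =
        ∑ f, ∑ g, Z f ω * Z g ω - 2 * (N * q) * ∑ f, Z f ω + (N * q) ^ 2 := by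
      intro ω
      rw [← Finset.sum_mul_sum]; ring
    simp_rw [h1]
    rw [integral_add (hint _) (hint _), integral_sub (hint _) (hint _), integral_const_mul,
      integral_finsetSum _ (fun _ _ => hint _), integral_finsetSum _ (fun _ _ => hint _)]
    simp_rw [integral_finsetSum _ (fun _ _ => hint _), hZ, hZZ]
    simp [← hN]
    ring
  have hlow : (N * q) ^ 2 * μ.real {ω | ∀ f, ω ∉ E f} ≤ ∫ ω, (∑ f, Z f ω - N * q) ^ 2 ∂μ := by
    rw [← integral_indicator_one (.of_discrete), ← integral_const_mul]
    refine integral_mono (hint _) (hint _) fun ω => ?_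
    by_cases hω : ∀ f, ω ∉ E f
    · simp [Z, hω]
    · have : ω ∉ {ω | ∀ f, ω ∉ E f} := hω
      simp only [Set.indicator_of_notMem this, mul_zero]
      positivity
  have hup : ∑ f, ∑ g, μ.real (E f ∩ E g) ≤ q ^ 2 * (N ^ 2 + ∑ f, ∑ g, r f g) := by
    calc _ ≤ ∑ f, ∑ g, q ^ 2 * (1 + r f g) :=
          Finset.sum_le_sum fun f _ => Finset.sum_le_sum fun g _ => hr f g
      _ = _ := by
          simp_rw [← Finset.mul_sum, Finset.sum_add_distrib]
          congr 1
          simp [← hN]; ring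
  rw [le_div_iff₀ (by positivity)]
  have hq2 : 0 < q ^ 2 := by positivity
  refine le_of_mul_le_mul_left ?_ hq2
  nlinarith

theorem _root_.SimpleGraph.IsAcyclic.card_edgeFinset_lt {V : Type*} [Fintype V] [Nonempty V]
    {G : SimpleGraph V} [Fintype G.edgeSet] (hG : G.IsAcyclic) :
    G.edgeFinset.card < Fintype.card V := by
  classical
  obtain ⟨T, hGT, -, hT⟩ :=
    (connected_top (V := V)).exists_isTree_le_of_le_of_isAcyclic le_top hG
  have h1 := hT.card_edgeFinset
  have h2 : G.edgeFinset.card ≤ T.edgeFinset.card := Finset.card_le_card (by simpa using hGT)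
  omega

theorem card_filter_agree {W : Type*} [Fintype W] [DecidableEq W] (m : ℕ) (A : Finset W)
    (f : W → Fin m) :
    (Finset.univ.filter fun g : W → Fin m => ∀ x ∈ A, f x = g x).card =
      m ^ (Fintype.card W - A.card) := by
  have : (Finset.univ.filter fun g : W → Fin m => ∀ x ∈ A, f x = g x) =
      Fintype.piFinset fun x => if x ∈ A then {f x} else Finset.univ := by
    ext g
    simp only [Finset.mem_filter, Finset.mem_univ, true_and, Fintype.mem_piFinset]
    refine forall_congr' fun x => ?_
    by_cases hx : x ∈ A <;> simp [hx, eq_comm]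
  rw [this, Fintype.card_piFinset]
  simp_rw [apply_ite Finset.card]
  rw [Finset.prod_ite]
  simp only [Finset.card_singleton, Finset.prod_const_one, one_mul, Finset.card_univ,
    Fintype.card_fin, Finset.prod_const]
  congr 1
  rw [Finset.filter_not, Finset.card_sdiff_of_subset (Finset.filter_subset _ _)]
  simp

/-- Given disjoint vertex classes of size `m` indexed by the vertices of a forest `T`, a bound on
the probability that the binomial random graph has no copy of `T` with each vertex in its own
class. A potential copy is given by a choice function `f`; the sum is over the sets `A` on which two
choice functions may agree, and correlation costs a factor `p⁻¹` per common edge, of which there are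
at most `|A| - 1`. -/
theorem binomialRandom_real_no_partite_copy_le {W : Type*} [Fintype W] [DecidableEq W]
    (T : SimpleGraph W) (hT : T.IsAcyclic) {n m : ℕ} (hm : 0 < m) (ι : W × Fin m ↪ Fin n)
    (p : unitInterval) (hp : 0 < (p : ℝ)) :
    (binomialRandom (Fin n) p).real {G | ¬ ∃ f : W → Fin m, ∀ x y, T.Adj x y →
        G.Adj (ι (x, f x)) (ι (y, f y))} ≤
      ∑ A ∈ (Finset.univ : Finset (Finset W)).filter (·.Nonempty),
        ((m : ℝ) ^ A.card * (p : ℝ) ^ (A.card - 1))⁻¹ := by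
  classical
  have : NeZero m := ⟨hm.ne'⟩
  let φ : (W → Fin m) → W ↪ Fin n := fun f =>
    ⟨fun x => ι (x, f x), fun x y h => (Prod.ext_iff.1 (ι.injective h)).1⟩
  let S : (W → Fin m) → Finset (Sym2 (Fin n)) := fun f =>
    T.edgeFinset.map ⟨Sym2.map (φ f), Sym2.map.injective (φ f).injective⟩
  let E : (W → Fin m) → Set (SimpleGraph (Fin n)) := fun f => {G | (S f : Set _) ⊆ G.edgeSet}
  have hSdiag : ∀ f, ∀ e ∈ S f, ¬ e.IsDiag := by
    intro f e he
    obtain ⟨e', he', rfl⟩ := Finset.mem_map.1 he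
    have h := T.not_isDiag_of_mem_edgeSet (mem_edgeFinset.1 he')
    simpa [Sym2.isDiag_map (φ f).injective] using h
  have hmemE : ∀ f G, G ∈ E f ↔ ∀ x y, T.Adj x y → G.Adj (ι (x, f x)) (ι (y, f y)) := by
    intro f G
    simp only [E, S, Set.mem_ofPred_eq, Set.subset_def, Finset.mem_coe, Finset.mem_map,
      forall_exists_index, and_imp]
    constructor
    · intro h x y hxy
      exact h _ s(x, y) (by simpa using hxy) rfl
    · rintro h _ e he rfl
      induction e using Sym2.ind with
      | _ x y => exact h x y (by simpa using he)
  set e := T.edgeFinset.card with he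
  have hScard : ∀ f, (S f).card = e := fun f => Finset.card_map _
  -- Edges common to two potential copies live on the set where the two functions agree.
  have hinter : ∀ f g, ((Finset.univ.filter fun x => f x = g x) = ∅ → S f ∩ S g = ∅) ∧
      ((Finset.univ.filter fun x => f x = g x).Nonempty →
        (S f ∩ S g).card ≤ (Finset.univ.filter fun x => f x = g x).card - 1) := by
    intro f g
    set A := Finset.univ.filter fun x => f x = g x with hA
    have hsub : S f ∩ S g ⊆ (T.induce (A : Set W)).edgeFinset.image
        (Sym2.map fun a => φ f a.1) := by
      intro d hd
      obtain ⟨h1, h2⟩ := Finset.mem_inter.1 hd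
      obtain ⟨d₁, hd₁, rfl⟩ := Finset.mem_map.1 h1
      obtain ⟨d₂, hd₂, h12⟩ := Finset.mem_map.1 h2
      induction d₁ using Sym2.ind with
      | _ x y =>
      induction d₂ using Sym2.ind with
      | _ x' y' =>
        have hxy : T.Adj x y := by simpa using hd₁
        have hagree : x ∈ A ∧ y ∈ A := by
          change Sym2.map (φ g) s(x', y') = Sym2.map (φ f) s(x, y) at h12
          have hφ : ∀ f x, φ f x = ι (x, f x) := fun _ _ => rfl
          simp only [Sym2.map_mk, Sym2.eq_iff, hφ, ι.injective.eq_iff, Prod.mk.injEq] at h12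
          simp only [hA, Finset.mem_filter, Finset.mem_univ, true_and]
          rcases h12 with ⟨⟨rfl, h⟩, rfl, h'⟩ | ⟨⟨rfl, h⟩, rfl, h'⟩
          · exact ⟨h.symm, h'.symm⟩
          · exact ⟨h'.symm, h.symm⟩
        refine Finset.mem_image.2 ⟨s(⟨x, hagree.1⟩, ⟨y, hagree.2⟩), ?_, rfl⟩
        simpa using hxy
    constructor
    · intro h0
      refine Finset.subset_empty.1 (hsub.trans ?_)
      have : IsEmpty (A : Set W) := by rw [h0]; simp
      intro d hd
      obtain ⟨d', -, -⟩ := Finset.mem_image.1 hd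
      induction d' using Sym2.ind with
      | _ x y => exact isEmptyElim x
    · rintro ⟨a, ha⟩
      have : Nonempty (A : Set W) := ⟨⟨a, ha⟩⟩
      have h1 := (hT.induce (A : Set W)).card_edgeFinset_lt
      have h2 := (Finset.card_le_card hsub).trans Finset.card_image_le
      have h3 : Fintype.card (A : Set W) = A.card := by simp
      omega
  set r : (W → Fin m) → (W → Fin m) → ℝ := fun f g =>
    ∑ A ∈ (Finset.univ : Finset (Finset W)).filter (·.Nonempty),
      if ∀ x ∈ A, f x = g x then ((p : ℝ) ^ (A.card - 1))⁻¹ else 0 with hr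
  have hcor : ∀ f g, (binomialRandom (Fin n) p).real (E f ∩ E g) ≤
      ((p : ℝ) ^ e) ^ 2 * (1 + r f g) := by
    intro f g
    have hEE : E f ∩ E g = {G | ((S f ∪ S g : Finset _) : Set _) ⊆ G.edgeSet} := by
      ext G; simp [E, Set.union_subset_iff]
    rw [hEE, binomialRandom_real_subset_edgeSet _ _ (by
      intro d hd
      rcases Finset.mem_union.1 hd with h | h
      exacts [hSdiag _ _ h, hSdiag _ _ h])]
    have hcard : (S f ∪ S g).card + (S f ∩ S g).card = 2 * e := by
      rw [Finset.card_union_add_card_inter, hScard, hScard]; ring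
    have hnn : ∀ A ∈ (Finset.univ : Finset (Finset W)).filter (·.Nonempty),
        0 ≤ if ∀ x ∈ A, f x = g x then ((p : ℝ) ^ (A.card - 1))⁻¹ else 0 := by
      intro A _
      split_ifs <;> positivity
    rcases (Finset.univ.filter fun x => f x = g x).eq_empty_or_nonempty with h0 | h0
    · have hr0 : 0 ≤ r f g := Finset.sum_nonneg hnn
      rw [(hinter f g).1 h0, Finset.card_empty, add_zero] at hcard
      rw [hcard, pow_mul', le_mul_iff_one_le_right (by positivity)]
      linarith
    · have hk := (hinter f g).2 h0
      set A := Finset.univ.filter fun x => f x = g x with hA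
      have hrA : ((p : ℝ) ^ (A.card - 1))⁻¹ ≤ r f g := by
        have := Finset.single_le_sum hnn (a := A) (by simpa using h0)
        refine le_trans (le_of_eq ?_) this
        rw [if_pos]
        intro x hx
        simpa [hA] using hx
      have hpk : (p : ℝ) ^ (A.card - 1) ≤ (p : ℝ) ^ (S f ∩ S g).card :=
        pow_le_pow_of_le_one hp.le p.2.2 hk
      calc (p : ℝ) ^ (S f ∪ S g).card
          = (p : ℝ) ^ (S f ∪ S g).card * (p : ℝ) ^ (A.card - 1) *
            ((p : ℝ) ^ (A.card - 1))⁻¹ := by field_simp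
        _ ≤ (p : ℝ) ^ (S f ∪ S g).card * (p : ℝ) ^ (S f ∩ S g).card *
            ((p : ℝ) ^ (A.card - 1))⁻¹ := by gcongr
        _ = ((p : ℝ) ^ e) ^ 2 * ((p : ℝ) ^ (A.card - 1))⁻¹ := by
            rw [← pow_add, hcard, pow_mul']
        _ ≤ _ := by gcongr; linarith
  have hmain := measureReal_forall_notMem_le (binomialRandom (Fin n) p) E
    (q := (p : ℝ) ^ e) (by positivity)
    (fun f => by rw [← hScard f]; exact binomialRandom_real_subset_edgeSet _ _ (hSdiag f)) r hcor
  have hset : {G | ¬ ∃ f : W → Fin m, ∀ x y, T.Adj x y → G.Adj (ι (x, f x)) (ι (y, f y))} =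
      {G | ∀ f, G ∉ E f} := by
    ext G; simp only [Set.mem_ofPred_eq, not_exists, hmemE]
  rw [hset]
  refine hmain.trans (le_of_eq ?_)
  have hsum : ∑ f, ∑ g, r f g = ∑ A ∈ (Finset.univ : Finset (Finset W)).filter (·.Nonempty),
      (m : ℝ) ^ Fintype.card W * (m : ℝ) ^ (Fintype.card W - A.card) *
        ((p : ℝ) ^ (A.card - 1))⁻¹ := by
    simp_rw [hr]
    rw [Finset.sum_congr rfl fun f _ => Finset.sum_comm, Finset.sum_comm]
    refine Finset.sum_congr rfl fun A _ => ?_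
    simp_rw [← Finset.sum_filter, Finset.sum_const, card_filter_agree]
    simp
    ring
  rw [hsum, Finset.sum_div]
  refine Finset.sum_congr rfl fun A _ => ?_
  have hAW : A.card ≤ Fintype.card W := Finset.card_le_univ A
  have hm' : (0 : ℝ) < m := by exact_mod_cast hm
  rw [Fintype.card_fun, Fintype.card_fin, Nat.cast_pow]
  have : (m : ℝ) ^ Fintype.card W = m ^ (Fintype.card W - A.card) * m ^ A.card := by
    rw [← pow_add, Nat.sub_add_cancel hAW]
  rw [this]
  field_simp

/-- The expected number of copies of `K` bounds the probability that there is one. -/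
theorem binomialRandom_real_isContained_le {a n : ℕ} (K : SimpleGraph (Fin a))
    (p : unitInterval) :
    (binomialRandom (Fin n) p).real {G | K.IsContained G} ≤
      (n : ℝ) ^ a * (p : ℝ) ^ K.edgeSet.ncard := by
  classical
  let S : (Fin a ↪ Fin n) → Finset (Sym2 (Fin n)) := fun f =>
    K.edgeFinset.map ⟨Sym2.map f, Sym2.map.injective f.injective⟩
  have hsub : {G : SimpleGraph (Fin n) | K.IsContained G} ⊆
      ⋃ f : Fin a ↪ Fin n, {G | (S f : Set _) ⊆ G.edgeSet} := by
    rintro G ⟨c⟩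
    refine Set.mem_iUnion.2 ⟨c.toEmbedding, ?_⟩
    intro d hd
    obtain ⟨d', hd', rfl⟩ := Finset.mem_map.1 (Finset.mem_coe.1 hd)
    induction d' using Sym2.ind with
    | _ x y => exact c.toHom.map_adj (by simpa using hd')
  refine (measureReal_mono hsub).trans ((measureReal_iUnion_fintype_le _).trans ?_)
  have hprob : ∀ f, (binomialRandom (Fin n) p).real {G | (S f : Set _) ⊆ G.edgeSet} =
      (p : ℝ) ^ K.edgeSet.ncard := by
    intro f
    rw [binomialRandom_real_subset_edgeSet, Finset.card_map, Set.ncard_eq_toFinset_card']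
    · rfl
    · intro d hd
      obtain ⟨e', he', rfl⟩ := Finset.mem_map.1 hd
      have h := K.not_isDiag_of_mem_edgeSet (mem_edgeFinset.1 he')
      simpa [Sym2.isDiag_map f.injective] using h
  simp_rw [hprob]
  rw [Finset.sum_const, nsmul_eq_mul]
  refine mul_le_mul_of_nonneg_right ?_ (pow_nonneg p.2.1 _)
  have : Fintype.card (Fin a ↪ Fin n) ≤ n ^ a := by
    rw [Fintype.card_embedding_eq]
    simpa using Nat.descFactorial_le_pow n a
  exact_mod_cast this

end Probability

/-! ### Playing on many disjoint copies -/

section Copies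

/-- Maker wins the game for a graph if, for each of its components, the board contains many copies
of a graph on which Maker wins the game for this component, all of these copies being
disjoint. -/
theorem makerWins_of_disjoint_copies {V : Type*} [Fintype V] (H : SimpleGraph V) {b : ℕ}
    (hb : 1 ≤ b) {W : H.ConnectedComponent → Type*} [∀ i, Fintype (W i)]
    [∀ i, DecidableEq (W i)] (T : ∀ i, SimpleGraph (W i))
    (hT : ∀ i, MakerWins b .maker i.toSimpleGraph (T i)) {s K : ℕ}
    (hs : ∀ i, Fintype.card (W i) ≤ s) (hK : Nat.card H.ConnectedComponent * (b * s + b) < K)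
    {X : Type*} [Fintype X] [DecidableEq X] (G : SimpleGraph X)
    (e : ∀ j : H.ConnectedComponent × Fin K, W j.1 ↪ X)
    (he : ∀ j x y, (T j.1).Adj x y → G.Adj (e j x) (e j y))
    (hdisj : ∀ j j', j ≠ j' → ∀ x y, e j x ≠ e j' y) (t : Player) :
    MakerWins b t H G := by
  classical
  have := Fintype.ofFinite H.ConnectedComponent
  rw [Nat.card_eq_fintype_card] at hK
  have hBd : ∀ i c j d, (i, c) ≠ (j, d) →
      Disjoint (Finset.univ.map (e (i, c))) (Finset.univ.map (e (j, d))) := by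
    intro i c j d hne
    rw [Finset.disjoint_left]
    intro z hz hz'
    obtain ⟨x, -, rfl⟩ := Finset.mem_map.1 hz
    obtain ⟨y, -, hy⟩ := Finset.mem_map.1 hz'
    exact hdisj _ _ hne x y hy.symm
  refine makerWinsFrom_of_many_boards hb
    (fun (i : H.ConnectedComponent) (M : Finset X) =>
      i.toSimpleGraph.IsContained (G.induce (M : Set X)))
    (fun i (c : Fin K) => Finset.univ.map (e (i, c))) s hBd (fun i c => by simpa using hs i)
    (fun i c => MakerWins.of_copy hb _ (he (i, c)) (hT i)) Finset.univ t ∅ Finset.univ ?_ ?_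
  · intro i _
    simpa using hK
  · intro M _ hM
    choose! N hNM c hN using fun i => hM i (Finset.mem_univ i)
    choose c hc using c
    have φ : ∀ i, SimpleGraph.Copy i.toSimpleGraph (G.induce (N i : Set X)) := fun i => (hN i).some
    let f : V → X := fun v => (φ (H.connectedComponentMk v) ⟨v, rfl⟩).1
    have hf : ∀ i v (hv : H.connectedComponentMk v = i), f v = (φ i ⟨v, hv⟩).1 := by
      rintro _ v rfl; rfl
    refine ⟨⟨⟨fun v => ⟨f v, hNM _ (φ (H.connectedComponentMk v) ⟨v, rfl⟩).2⟩, ?_⟩, ?_⟩⟩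
    · intro u v huv
      have hc : H.connectedComponentMk u = H.connectedComponentMk v :=
        SimpleGraph.ConnectedComponent.connectedComponentMk_eq_of_adj huv
      change G.Adj (f u) (f v)
      rw [hf _ u hc, hf _ v rfl]
      have huv' : (H.connectedComponentMk v).toSimpleGraph.Adj ⟨u, hc⟩ ⟨v, rfl⟩ := huv
      exact (φ (H.connectedComponentMk v)).toHom.map_adj huv'
    · intro u v huv
      have huv' : f u = f v := congrArg Subtype.val huv
      by_cases hcomp : H.connectedComponentMk u = H.connectedComponentMk v
      · rw [hf _ u hcomp, hf _ v rfl] at huv'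
        exact congrArg Subtype.val
          ((φ (H.connectedComponentMk v)).injective (Subtype.ext huv'))
      · have h1 : f u ∈ _ := hc _ (φ (H.connectedComponentMk u) ⟨u, rfl⟩).2
        have h2 : f v ∈ _ := hc _ (φ (H.connectedComponentMk v) ⟨v, rfl⟩).2
        have hne : (H.connectedComponentMk u, c (H.connectedComponentMk u)) ≠
            (H.connectedComponentMk v, c (H.connectedComponentMk v)) := by
          intro h; exact hcomp (Prod.ext_iff.1 h).1
        exact absurd (huv' ▸ h1) (Finset.disjoint_right.1 (hBd _ _ _ _ hne) h2)

end Copies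

/-! ### Above the threshold -/

section Supercritical

open MeasureTheory SimpleGraph

/-- Above the threshold for trees with `v` vertices, the expected number of copies of a tree with
`a ≤ v` vertices tends to infinity. -/
theorem tendsto_pow_mul_pow_atTop {v a : ℕ} (hv : 2 ≤ v) (ha : 1 ≤ a) (hav : a ≤ v)
    {p : ℕ → ℝ} (hp : ∀ n, 0 ≤ p n)
    (h : (fun n : ℕ => (n : ℝ) ^ (-((v : ℝ) / (v - 1 : ℕ)))) =o[atTop] p) :
    Tendsto (fun n : ℕ => (n : ℝ) ^ a * p n ^ (a - 1)) atTop atTop := by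
  set α : ℝ := (v : ℝ) / (v - 1 : ℕ) with hα
  have hv1 : (0 : ℝ) < (v - 1 : ℕ) := by exact_mod_cast (by omega : 0 < v - 1)
  have hy : Tendsto (fun n : ℕ => (n : ℝ) ^ α * p n) atTop atTop := by
    rw [tendsto_atTop]
    intro C
    have hC : (0 : ℝ) < max C 1 := lt_max_of_lt_right one_pos
    filter_upwards [isLittleO_iff.1 h (inv_pos.2 hC), eventually_ge_atTop 1] with n hn hn1
    have hn0 : (0 : ℝ) < n := by exact_mod_cast hn1
    rw [Real.norm_of_nonneg (by positivity), Real.norm_of_nonneg (hp n), Real.rpow_neg hn0.le,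
      inv_mul_eq_div, le_div_iff₀ hC, inv_mul_le_iff₀ (by positivity)] at hn
    exact (le_max_left _ _).trans hn
  rcases Nat.lt_or_ge 1 a with ha2 | ha2
  · have hya : Tendsto (fun n : ℕ => ((n : ℝ) ^ α * p n) ^ (a - 1)) atTop atTop :=
      (tendsto_pow_atTop (by omega)).comp hy
    refine tendsto_atTop_mono' _ ?_ hya
    filter_upwards [eventually_ge_atTop 1] with n hn1
    have hn0 : (1 : ℝ) ≤ n := by exact_mod_cast hn1
    rw [mul_pow]
    refine mul_le_mul_of_nonneg_right ?_ (pow_nonneg (hp n) _)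
    rw [← Real.rpow_natCast, ← Real.rpow_natCast, ← Real.rpow_mul (by positivity)]
    refine Real.rpow_le_rpow_of_exponent_le hn0 ?_
    rw [hα, div_mul_eq_mul_div, div_le_iff₀ hv1, Nat.cast_sub ha, Nat.cast_sub (by omega)]
    have : (a : ℝ) ≤ v := by exact_mod_cast hav
    push_cast
    nlinarith
  · obtain rfl : a = 1 := by omega
    simpa using tendsto_natCast_atTop_atTop (R := ℝ)

/-- Above the threshold for trees with `v` vertices, the binomial random graph asymptotically almost
surely contains any given finite collection of disjoint forests with at most `v` vertices each. -/
theorem tendsto_binomialRandom_disjoint_forests {J : Type*} [Fintype J] {W : J → Type*}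
    [∀ j, Fintype (W j)] (T : ∀ j, SimpleGraph (W j)) (hT : ∀ j, (T j).IsAcyclic) {v : ℕ}
    (hv : 2 ≤ v) (hW : ∀ j, Fintype.card (W j) ≤ v) (p : ℕ → unitInterval)
    (h : (fun n : ℕ => (n : ℝ) ^ (-((v : ℝ) / (v - 1 : ℕ)))) =o[atTop] fun n => (p n : ℝ)) :
    Tendsto (fun n => (binomialRandom (Fin n) (p n)).real
      {G | ∃ e : ∀ j, W j ↪ Fin n, (∀ j x y, (T j).Adj x y → G.Adj (e j x) (e j y)) ∧
        ∀ j j', j ≠ j' → ∀ x y, e j x ≠ e j' y}) atTop (𝓝 1) := by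
  classical
  -- `L` blocks of `n / L` vertices; adding one keeps `L` positive.
  set L := Fintype.card (Σ j, W j) + 1 with hL
  have hLpos : 0 < L := Nat.succ_pos _
  let bound : ℕ → ℝ := fun n => ∑ j, ∑ A ∈ (Finset.univ : Finset (Finset (W j))).filter
    (·.Nonempty), (((n / L : ℕ) : ℝ) ^ A.card * (p n : ℝ) ^ (A.card - 1))⁻¹
  have hbound : Tendsto bound atTop (𝓝 0) := by
    rw [← Finset.sum_const_zero (s := (Finset.univ : Finset J))]
    refine tendsto_finsetSum _ fun j _ => ?_
    rw [← Finset.sum_const_zero (s := (Finset.univ : Finset (Finset (W j))).filter (·.Nonempty))]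
    refine tendsto_finsetSum _ fun A hA => ?_
    have hA1 : 1 ≤ A.card := by simpa using hA
    have hAv : A.card ≤ v := (Finset.card_le_univ A).trans (hW j)
    refine tendsto_inv_atTop_zero.comp ?_
    have h1 := (tendsto_pow_mul_pow_atTop hv hA1 hAv (fun n => (p n).2.1) h).const_mul_atTop
      (show (0 : ℝ) < (2 * (L : ℝ))⁻¹ ^ A.card by positivity)
    refine tendsto_atTop_mono' _ ?_ h1
    filter_upwards [eventually_ge_atTop L] with n hn
    rw [← mul_assoc, ← mul_pow]
    refine mul_le_mul_of_nonneg_right ?_ (pow_nonneg (p n).2.1 _)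
    refine pow_le_pow_left₀ (by positivity) ?_ _
    rw [inv_mul_le_iff₀ (by positivity)]
    have h2 : 1 ≤ n / L := (Nat.one_le_div_iff hLpos).2 hn
    have h3 : n ≤ 2 * L * (n / L) := by
      have := Nat.lt_mul_div_succ n hLpos
      nlinarith
    exact_mod_cast h3
  have hpos : ∀ᶠ n in atTop, 0 < (p n : ℝ) := by
    filter_upwards [isLittleO_iff.1 h one_pos, eventually_ge_atTop 1] with n hn hn1
    have hn0 : (0 : ℝ) < n := by exact_mod_cast hn1
    rw [one_mul, Real.norm_of_nonneg (by positivity), Real.norm_of_nonneg (p n).2.1] at hn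
    exact lt_of_lt_of_le (by positivity) hn
  have hlow : ∀ᶠ n in atTop, 1 - bound n ≤ (binomialRandom (Fin n) (p n)).real
      {G | ∃ e : ∀ j, W j ↪ Fin n, (∀ j x y, (T j).Adj x y → G.Adj (e j x) (e j y)) ∧
        ∀ j j', j ≠ j' → ∀ x y, e j x ≠ e j' y} := by
    filter_upwards [hpos, eventually_ge_atTop L] with n hpn hn
    have hm : 0 < n / L := (Nat.one_le_div_iff hLpos).2 hn
    have hcard : Fintype.card ((Σ j, W j) × Fin (n / L)) ≤ Fintype.card (Fin n) := by
      rw [Fintype.card_prod, Fintype.card_fin, Fintype.card_fin]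
      calc _ ≤ L * (n / L) := Nat.mul_le_mul_right _ (Nat.le_succ _)
        _ ≤ n := Nat.mul_div_le n L
    obtain ⟨ι⟩ := Function.Embedding.nonempty_of_card_le hcard
    let κ : ∀ j, W j × Fin (n / L) ↪ Fin n := fun j =>
      ⟨fun x => ι (⟨j, x.1⟩, x.2), fun x y hxy => by
        have := ι.injective hxy
        simp only [Prod.mk.injEq, Sigma.mk.injEq, heq_eq_eq, true_and] at this
        exact Prod.ext this.1 this.2⟩
    set good := {G : SimpleGraph (Fin n) | ∃ e : ∀ j, W j ↪ Fin n,
      (∀ j x y, (T j).Adj x y → G.Adj (e j x) (e j y)) ∧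
        ∀ j j', j ≠ j' → ∀ x y, e j x ≠ e j' y}
    have hsub : goodᶜ ⊆ ⋃ j, {G | ¬ ∃ f : W j → Fin (n / L), ∀ x y, (T j).Adj x y →
        G.Adj (κ j (x, f x)) (κ j (y, f y))} := by
      intro G hG
      by_contra hcon
      simp only [Set.mem_iUnion, Set.mem_ofPred_eq, not_exists] at hcon
      push Not at hcon
      choose f hf using hcon
      refine hG ⟨fun j => ⟨fun x => κ j (x, f j x), fun x y hxy =>
        (Prod.ext_iff.1 ((κ j).injective hxy)).1⟩, hf, fun j j' hjj x y hxy => hjj ?_⟩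
      have := ι.injective hxy
      simp only [Prod.mk.injEq, Sigma.mk.injEq] at this
      exact this.1.1
    have hle : (binomialRandom (Fin n) (p n)).real goodᶜ ≤ bound n := by
      refine (measureReal_mono hsub).trans ((measureReal_iUnion_fintype_le _).trans ?_)
      exact Finset.sum_le_sum fun j _ =>
        binomialRandom_real_no_partite_copy_le (T j) (hT j) hm (κ j) (p n) hpn
    rw [probReal_compl_eq_one_sub .of_discrete] at hle
    linarith
  refine tendsto_of_tendsto_of_tendsto_of_le_of_le' ?_ tendsto_const_nhds hlow
    (Eventually.of_forall fun n => measureReal_le_one)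
  simpa using tendsto_const_nhds.sub hbound

end Supercritical

/-! ### Playing against a connected target -/

section Components

open SimpleGraph

/-- In the game for a connected graph, Maker moving first can only win on `G` if he wins moving
first on a single component of `G`. -/
theorem exists_connectedComponent_of_makerWins {U X : Type*} [Fintype X] [DecidableEq X] {b : ℕ}
    (hb : 1 ≤ b) {A : SimpleGraph U} (hA : A.Connected) (G : SimpleGraph X)
    [DecidableEq G.ConnectedComponent] (h : MakerWins b .maker A G) :
    ∃ C : G.ConnectedComponent,
      MakerWinsFrom b (fun M : Finset X => A.IsContained (G.induce (M : Set X))) .maker ∅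
        (Finset.univ.filter (G.connectedComponentMk · = C)) := by
  have hmono : Monotone fun M : Finset X => A.IsContained (G.induce (M : Set X)) :=
    fun M M' hM hA => hA.trans ⟨(G.induceHomOfLE (by simpa using hM)).toCopy⟩
  suffices hWin : ∀ M : Finset X, A.IsContained (G.induce (M : Set X)) → ∃ C : G.ConnectedComponent,
      A.IsContained (G.induce (M.filter (G.connectedComponentMk · = C) : Set X)) by
    obtain ⟨C, hC⟩ := MakerWinsFrom.exists_class hb G.connectedComponentMk
      (fun _ (M : Finset X) => A.IsContained (G.induce (M : Set X))) (fun _ => hmono) hWin _ _ h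
    exact ⟨C, by simpa using hC⟩
  rintro M ⟨φ⟩
  obtain ⟨u₀⟩ := hA.nonempty
  refine ⟨G.connectedComponentMk (φ u₀), ⟨⟨⟨fun u => ⟨φ u, ?_⟩, fun {u v} huv => ?_⟩, ?_⟩⟩⟩
  · have hr : G.Reachable (φ u) (φ u₀) :=
      ((hA.preconnected u u₀).map φ.toHom).map (Copy.induce G (M : Set X)).toHom
    simpa using hr
  · exact φ.toHom.map_adj huv
  · intro u v huv
    have := congrArg Subtype.val huv
    exact φ.injective (Subtype.ext this)

/-- A connected graph contains connected graphs of every smaller positive order. -/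
theorem exists_connected_isContained {v : ℕ} (hv : 1 ≤ v) (k : ℕ) :
    ∀ {V : Type*} [Fintype V] (G : SimpleGraph V), G.Connected → Fintype.card V = v + k →
      ∃ K : SimpleGraph (Fin v), K.Connected ∧ K.IsContained G := by
  induction k with
  | zero =>
    intro V _ G hG hV
    let e : Fin v ≃ V := (Fintype.equivFinOfCardEq hV).symm
    exact ⟨G.comap e, (Iso.comap e G).connected_iff.2 hG, (Iso.comap e G).isContained⟩
  | succ k ih =>
    intro V _ G hG hV
    classical
    have : Nontrivial V := Fintype.one_lt_card_iff_nontrivial.1 (by omega)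
    obtain ⟨x, hx⟩ := hG.exists_connected_induce_compl_singleton_of_finite_nontrivial
    obtain ⟨K, hK, hKG⟩ := ih (G.induce {x}ᶜ) hx (by
      rw [Fintype.card_compl_set, hV]; simp)
    exact ⟨K, hK, hKG.trans ⟨Copy.induce G _⟩⟩

/-- The graphs on at most `v` vertices, with vertex set `Fin a`, that have at least as many edges as
vertices, or else have exactly `v` vertices and at least `v - 1` edges. They are too dense to occur
in the binomial random graph below the threshold for trees with `v` vertices. -/
def denseGraphs (v : ℕ) : Set (Σ a : Fin (v + 1), SimpleGraph (Fin a)) :=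
  {K | (K.1.val = v ∧ v - 1 ≤ K.2.edgeSet.ncard) ∨
    (1 ≤ K.1.val ∧ K.1.val ≤ K.2.edgeSet.ncard)}

/-- If Maker wins on `G` the game for a connected graph `A`, then `G` contains a dense graph: all
trees with fewer vertices than the smallest on which Maker wins are lost for him, so some component
of `G` is too large or has a cycle. -/
theorem exists_denseGraphs_isContained {U W X : Type*} [Fintype W] [DecidableEq W] [Fintype X]
    [DecidableEq X] {b : ℕ} (hb : 1 ≤ b) {A : SimpleGraph U} (hA : A.Connected)
    {T : SimpleGraph W} (hT : IsMinMakerTree b A T) (hW : 1 ≤ Fintype.card W)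
    (G : SimpleGraph X) (h : MakerWins b .maker A G) :
    ∃ K ∈ denseGraphs (Fintype.card W), K.2.IsContained G := by
  classical
  obtain ⟨C, hC⟩ := exists_connectedComponent_of_makerWins hb hA G h
  have hconn := C.connected_toSimpleGraph
  set v := Fintype.card W with hv
  set m := Fintype.card C with hm
  have hCG : C.toSimpleGraph.IsContained G := ⟨Copy.induce G _⟩
  rcases le_or_gt v m with hvm | hvm
  · obtain ⟨K, hK, hKC⟩ := exists_connected_isContained hW (m - v) C.toSimpleGraph hconn (by omega)
    refine ⟨⟨Fin.last v, K⟩, .inl ⟨rfl, ?_⟩, hKC.trans hCG⟩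
    have := hK.card_vert_le_card_edgeSet_add_one
    rw [Nat.card_coe_set_eq, Nat.card_eq_fintype_card, Fintype.card_fin] at this
    exact (by omega : v - 1 ≤ K.edgeSet.ncard)
  · let e : Fin m ≃ C := (Fintype.equivFin C).symm
    let f : Fin m ↪ X := e.toEmbedding.trans (.subtype _)
    let K : SimpleGraph (Fin m) := G.comap f
    let iso : K ≃g C.toSimpleGraph := ⟨e, Iff.rfl⟩
    have hKconn : K.Connected := iso.connected_iff.2 hconn
    have hKwin : MakerWins b .maker A K := by
      refine hC.of_map f ?_ _ _ (by simp) ?_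
      · rintro M ⟨φ⟩
        have hφ : ∀ u, ∃ x ∈ M, f x = φ u := fun u => by
          simpa only [Finset.mem_coe, Finset.mem_map] using (φ u).2
        choose g hg hgf using hφ
        refine ⟨⟨⟨fun u => ⟨g u, hg u⟩, fun {u w} huw => ?_⟩, fun u w huw => ?_⟩⟩
        · change G.Adj (f (g u)) (f (g w))
          rw [hgf, hgf]
          exact φ.toHom.map_adj huw
        · have : g u = g w := congrArg Subtype.val huw
          exact φ.injective (Subtype.ext ((hgf u).symm.trans ((congrArg f this).trans (hgf w))))
      · ext x
        simp only [Finset.mem_filter, Finset.mem_univ, true_and, Finset.mem_map, f,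
          Function.Embedding.trans_apply]
        exact ⟨fun hx => ⟨e.symm ⟨x, hx⟩, by simp⟩, by
          rintro ⟨y, rfl⟩; exact (e y).2⟩
    have hKtree : ¬ K.IsTree := fun hK => (hT.2.2 m K hK hKwin).not_gt hvm
    have h1 := hKconn.card_vert_le_card_edgeSet_add_one
    rw [isTree_iff_connected_and_card] at hKtree
    have h2 : ¬ Nat.card K.edgeSet + 1 = Nat.card (Fin m) := fun h => hKtree ⟨hKconn, h⟩
    rw [Nat.card_coe_set_eq, Nat.card_eq_fintype_card, Fintype.card_fin] at h1 h2
    have hm1 : 1 ≤ m := by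
      have := hconn.nonempty
      exact Fintype.card_pos
    refine ⟨⟨⟨m, by omega⟩, K⟩, .inr ⟨hm1, ?_⟩, iso.isContained.trans hCG⟩
    exact (by omega : m ≤ K.edgeSet.ncard)

end Components

/-! ### Below the threshold -/

section Subcritical

open MeasureTheory SimpleGraph

/-- Below the threshold for trees with `v` vertices, the expected number of copies of each dense
graph tends to zero. -/
theorem tendsto_pow_mul_pow_nhds_zero {v a e : ℕ} (hv : 2 ≤ v)
    (hae : (a = v ∧ v - 1 ≤ e) ∨ (1 ≤ a ∧ a ≤ e)) {p : ℕ → ℝ} (hp : ∀ n, 0 ≤ p n)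
    (hp1 : ∀ n, p n ≤ 1)
    (h : p =o[atTop] fun n : ℕ => (n : ℝ) ^ (-((v : ℝ) / (v - 1 : ℕ)))) :
    Tendsto (fun n : ℕ => (n : ℝ) ^ a * p n ^ e) atTop (𝓝 0) := by
  set α : ℝ := (v : ℝ) / (v - 1 : ℕ) with hα
  have hv1 : (0 : ℝ) < (v - 1 : ℕ) := by exact_mod_cast (by omega : 0 < v - 1)
  have hy : Tendsto (fun n : ℕ => (n : ℝ) ^ α * p n) atTop (𝓝 0) := by
    refine h.tendsto_div_nhds_zero.congr' ?_
    filter_upwards with n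
    rw [Real.rpow_neg (Nat.cast_nonneg n), div_inv_eq_mul, mul_comm]
  suffices ∃ k, k ≠ 0 ∧ ∀ᶠ n : ℕ in atTop,
      (n : ℝ) ^ a * p n ^ e ≤ ((n : ℝ) ^ α * p n) ^ k by
    obtain ⟨k, hk, hle⟩ := this
    have hyk := hy.pow k
    rw [zero_pow hk] at hyk
    exact tendsto_of_tendsto_of_tendsto_of_le_of_le' tendsto_const_nhds hyk
      (Eventually.of_forall fun n => mul_nonneg (by positivity) (pow_nonneg (hp n) _)) hle
  rcases hae with ⟨rfl, hae⟩ | ⟨ha, hae⟩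
  · refine ⟨a - 1, by omega, Eventually.of_forall fun n => ?_⟩
    rw [mul_pow, ← Real.rpow_natCast ((n : ℝ) ^ α), ← Real.rpow_mul (Nat.cast_nonneg n), hα,
      div_mul_cancel₀ _ hv1.ne', Real.rpow_natCast]
    exact mul_le_mul_of_nonneg_left (pow_le_pow_of_le_one (hp n) (hp1 n) hae) (by positivity)
  · refine ⟨a, by omega, ?_⟩
    filter_upwards [eventually_ge_atTop 1] with n hn
    have hn1 : (1 : ℝ) ≤ n := by exact_mod_cast hn
    have hα1 : 1 ≤ α := by
      rw [hα, one_le_div hv1]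
      exact_mod_cast Nat.sub_le v 1
    calc (n : ℝ) ^ a * p n ^ e ≤ (n : ℝ) ^ a * p n ^ a :=
          mul_le_mul_of_nonneg_left (pow_le_pow_of_le_one (hp n) (hp1 n) hae) (by positivity)
      _ = ((n : ℝ) * p n) ^ a := (mul_pow _ _ _).symm
      _ ≤ _ := by
        refine pow_le_pow_left₀ (mul_nonneg (by positivity) (hp n)) ?_ _
        refine mul_le_mul_of_nonneg_right ?_ (hp n)
        simpa using Real.rpow_le_rpow_of_exponent_le hn1 hα1

/-- Below the threshold for trees with `v` vertices, the binomial random graph asymptotically almost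
surely contains no dense graph. -/
theorem tendsto_binomialRandom_denseGraphs {v : ℕ} (hv : 2 ≤ v) (p : ℕ → unitInterval)
    (h : (fun n => (p n : ℝ)) =o[atTop] fun n : ℕ => (n : ℝ) ^ (-((v : ℝ) / (v - 1 : ℕ)))) :
    Tendsto (fun n => (binomialRandom (Fin n) (p n)).real
      {G | ∃ K ∈ denseGraphs v, K.2.IsContained G}) atTop (𝓝 0) := by
  classical
  have := Fintype.ofFinite (denseGraphs v)
  have hlim : Tendsto (fun n : ℕ => ∑ K : denseGraphs v,
      (n : ℝ) ^ K.1.1.val * (p n : ℝ) ^ K.1.2.edgeSet.ncard) atTop (𝓝 0) := by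
    rw [← Finset.sum_const_zero (s := (Finset.univ : Finset (denseGraphs v)))]
    exact tendsto_finsetSum _ fun K _ => tendsto_pow_mul_pow_nhds_zero hv K.2
      (fun n => (p n).2.1) (fun n => (p n).2.2) h
  refine squeeze_zero (fun n => measureReal_nonneg) (fun n => ?_) hlim
  have hsub : {G : SimpleGraph (Fin n) | ∃ K ∈ denseGraphs v, K.2.IsContained G} ⊆
      ⋃ K : denseGraphs v, {G | K.1.2.IsContained G} := by
    rintro G ⟨K, hK, hKG⟩
    exact Set.mem_iUnion.2 ⟨⟨K, hK⟩, hKG⟩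
  exact (measureReal_mono hsub).trans ((measureReal_iUnion_fintype_le _).trans
    (Finset.sum_le_sum fun K _ => binomialRandom_real_isContained_le K.1.2 (p n)))

end Subcritical

/-! ### The density of a tree -/

section Density

open SimpleGraph

theorem ncard_edgeSet_of_isTree {W : Type*} [Fintype W] {T : SimpleGraph W} (hT : T.IsTree) :
    T.edgeSet.ncard = Fintype.card W - 1 := by
  classical
  rw [Set.ncard_eq_toFinset_card', ← hT.card_edgeFinset, Nat.add_sub_cancel]
  rfl

theorem maxDensity_of_isTree {W : Type*} [Fintype W] {T : SimpleGraph W} (hT : T.IsTree) :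
    maxDensity T = (T.edgeSet.ncard : ℝ) / Fintype.card W := by
  classical
  have hpos : (0 : ℝ) < Fintype.card W := by
    have := hT.connected.nonempty
    exact_mod_cast Fintype.card_pos
  have hle : ∀ K : T.Subgraph, (K.edgeSet.ncard : ℝ) / (K.verts.ncard : ℝ) ≤
      (T.edgeSet.ncard : ℝ) / Fintype.card W := by
    intro K
    rcases K.verts.eq_empty_or_nonempty with h0 | h0
    · rw [h0]; simp; positivity
    have := h0.to_subtype
    have h1 := (hT.isAcyclic.subgraph K).card_edgeFinset_lt
    have h2 : K.edgeSet.ncard ≤ K.coe.edgeFinset.card := by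
      rw [← Subgraph.image_coe_edgeSet_coe, ← Set.ncard_coe_finset, coe_edgeFinset]
      exact Set.ncard_image_le
    have h3 : Fintype.card K.verts = K.verts.ncard := by
      rw [← Nat.card_eq_fintype_card, Nat.card_coe_set_eq]
    have h4 : K.verts.ncard ≤ Fintype.card W := by
      rw [← h3]; exact Fintype.card_subtype_le _
    have h5 : K.edgeSet.ncard + 1 ≤ K.verts.ncard := by omega
    have h6 : T.edgeSet.ncard + 1 = Fintype.card W := by
      have hW : 0 < Fintype.card W := by exact_mod_cast hpos
      rw [ncard_edgeSet_of_isTree hT]; omega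
    have hkpos : (0 : ℝ) < K.verts.ncard := by exact_mod_cast (by omega : 0 < K.verts.ncard)
    rw [div_le_div_iff₀ hkpos hpos]
    have h4' : (K.verts.ncard : ℝ) ≤ Fintype.card W := by exact_mod_cast h4
    have h5' : (K.edgeSet.ncard : ℝ) + 1 ≤ K.verts.ncard := by exact_mod_cast h5
    have h6' : (T.edgeSet.ncard : ℝ) + 1 = Fintype.card W := by exact_mod_cast h6
    nlinarith
  refine le_antisymm (ciSup_le hle) ?_
  have h := le_ciSup (f := fun K : T.Subgraph => (K.edgeSet.ncard : ℝ) / (K.verts.ncard : ℝ))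
    ⟨_, Set.forall_mem_range.2 hle⟩ ⊤
  simpa [maxDensity, Set.ncard_univ] using h

end Density

/-! ### The threshold -/

section Threshold

open SimpleGraph

/-- Containing an edge takes two vertices. -/
theorem two_le_card_of_makerWins {U W : Type*} [Fintype W] [DecidableEq W] [Nontrivial U] {b : ℕ}
    {t : Player} {A : SimpleGraph U} {T : SimpleGraph W} (h : MakerWins b t A T) :
    2 ≤ Fintype.card W := by
  obtain ⟨N, -, ⟨φ⟩⟩ := MakerWinsFrom.exists_win h
  obtain ⟨u, v, huv⟩ := exists_pair_ne U
  refine Fintype.one_lt_card_iff.2 ⟨φ u, φ v, fun h => huv (φ.injective (Subtype.ext h))⟩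

theorem MakerWins.maker_of_any {U X : Type*} [Fintype X] [DecidableEq X] {b : ℕ} (hb : 1 ≤ b)
    {t : Player} {A : SimpleGraph U} {G : SimpleGraph X} (h : MakerWins b t A G) :
    MakerWins b .maker A G := by
  cases t with
  | maker => exact h
  | breaker =>
    refine MakerWinsFrom.maker_of_breaker hb (fun M M' hM hA => hA.trans ?_) h
    exact ⟨(G.induceHomOfLE (by simpa using hM)).toCopy⟩

theorem MakerWins.mono_target {U U' X : Type*} [Fintype X] [DecidableEq X] {b : ℕ}
    (hb : 1 ≤ b) {t : Player} {A : SimpleGraph U} {A' : SimpleGraph U'} (hA : A.IsContained A')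
    {G : SimpleGraph X} (h : MakerWins b t A' G) : MakerWins b t A G := by
  refine MakerWinsFrom.map_mono hb (.refl X) (fun M M' hM hMM => ?_) h _ _ (by simp) (by simp)
  exact (hA.trans hM).trans ⟨(G.induceHomOfLE (by simpa using hMM)).toCopy⟩

/-- The threshold in terms of the number `v` of vertices of the largest minimal tree, which has
`v - 1 ≥ 1` edges. -/
theorem isThreshold_makerWins {V : Type*} [Fintype V] {H : SimpleGraph V} (hH : H ≠ ⊥) {b : ℕ}
    (hb : 1 ≤ b) {W : H.ConnectedComponent → Type*} [∀ i, Fintype (W i)]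
    [∀ i, DecidableEq (W i)] (T : ∀ i, SimpleGraph (W i))
    (hT : ∀ i, IsMinMakerTree b i.toSimpleGraph (T i)) (i : H.ConnectedComponent)
    (hi : ∀ j, Fintype.card (W j) ≤ Fintype.card (W i)) (first : Player) :
    IsThreshold (fun _ G => MakerWins b first H G) (fun n =>
      (n : ℝ) ^ (-((Fintype.card (W i) : ℝ) / (Fintype.card (W i) - 1 : ℕ)))) := by
  classical
  have hv : 2 ≤ Fintype.card (W i) := by
    obtain ⟨u, v, huv⟩ := ne_bot_iff_exists_adj.1 hH
    have hc := ConnectedComponent.connectedComponentMk_eq_of_adj huv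
    have : Nontrivial (H.connectedComponentMk v) :=
      ⟨⟨u, hc⟩, ⟨v, rfl⟩, fun h => huv.ne (congrArg Subtype.val h)⟩
    exact (two_le_card_of_makerWins (hT (H.connectedComponentMk v)).2.1).trans (hi _)
  have := Fintype.ofFinite H.ConnectedComponent
  intro p
  constructor
  · intro hp
    -- Enough copies for every component to leave an untouched one whenever Maker needs it.
    let K := Nat.card H.ConnectedComponent * (b * Fintype.card (W i) + b) + 1
    have hlim := tendsto_binomialRandom_disjoint_forests
      (J := H.ConnectedComponent × Fin K) (fun j => T j.1) (fun j => (hT j.1).1.isAcyclic) hv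
      (fun j => hi j.1) p hp
    refine tendsto_of_tendsto_of_tendsto_of_le_of_le hlim tendsto_const_nhds (fun n => ?_)
      (fun n => MeasureTheory.measureReal_le_one)
    refine MeasureTheory.measureReal_mono ?_
    rintro G ⟨e, he, hdisj⟩
    exact makerWins_of_disjoint_copies H hb T (fun i => (hT i).2.1) hi (Nat.lt_succ_self _) G e he
      hdisj first
  · intro hp
    refine squeeze_zero (fun n => MeasureTheory.measureReal_nonneg) (fun n => ?_)
      (tendsto_binomialRandom_denseGraphs hv p hp)
    refine MeasureTheory.measureReal_mono ?_
    intro G hG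
    exact exists_denseGraphs_isContained hb i.connected_toSimpleGraph (hT i) (by omega) G
      ((MakerWins.maker_of_any hb hG).mono_target hb ⟨Copy.induce H _⟩)

end Threshold

end VertexGame

theorem mainTheorem3 {V : Type*} [Fintype V] (H : SimpleGraph V) (hH : H.IsAcyclic)
    (b : ℕ) (hb : 1 ≤ b) :
    (H.IsTree →
      ∃ (m : ℕ) (T : SimpleGraph (Fin m)), T.IsTree ∧
        ∀ first : VertexGame.Player, VertexGame.MakerWins b first H T) ∧
    (H ≠ ⊥ →
      ∀ (W : H.ConnectedComponent → Type*) [∀ i, Fintype (W i)] [∀ i, DecidableEq (W i)]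
        (Tmin : ∀ i, SimpleGraph (W i)),
        (∀ i, VertexGame.IsMinMakerTree b i.toSimpleGraph (Tmin i)) →
        ∀ i : H.ConnectedComponent, (∀ j, Fintype.card (W j) ≤ Fintype.card (W i)) →
          (∀ first : VertexGame.Player,
            VertexGame.IsThreshold (fun _ G => VertexGame.MakerWins b first H G)
              (fun n => (n : ℝ) ^ (-(1 / VertexGame.maxDensity (Tmin i))))) ∧
          ∀ n : ℕ, (n : ℝ) ^ (-(1 / VertexGame.maxDensity (Tmin i))) =
            (n : ℝ) ^ (-((Fintype.card (W i) : ℝ) / ((Tmin i).edgeSet.ncard : ℝ)))) := by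
  refine ⟨fun hT => VertexGame.exists_isTree_makerWins H hT hb, ?_⟩
  intro hne W _ _ Tmin hTmin i hi
  have hdens : 1 / VertexGame.maxDensity (Tmin i) =
      (Fintype.card (W i) : ℝ) / ((Tmin i).edgeSet.ncard : ℝ) := by
    rw [VertexGame.maxDensity_of_isTree (hTmin i).1, one_div_div]
  refine ⟨fun first => ?_, fun n => by rw [hdens]⟩
  rw [hdens, VertexGame.ncard_edgeSet_of_isTree (hTmin i).1]
  exact VertexGame.isThreshold_makerWins hne hb Tmin hTmin i hi first
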